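/- Let $(M^m,g)$ be a smooth Riemannian manifold, $(N^{2n},J,h)$ a Kähler manifold of real dimension $2n$, and let $\varphi:M\to N$ be a smooth submersion which is pseudo horizontally weakly conformal (PHWC), i.e. $[d\varphi_x\circ d\varphi_x^{*},J_{\varphi(x)}]=0$ for all $x\in M$, where $d\varphi_x^{*}:T_{\varphi(x)}N\to T_xM$ is the adjoint of $d\varphi_x$ with respect to $g$ and $h$. Let $\mathcal V=\ker d\varphi$ and $\mathcal H=\mathcal V^{\perp}$ be the vertical and horizontal distributions; denote the $g$-orthogonal projections onto them by the same letters, and put $g^{\mathcal H}=g(\mathcal H\cdot,\mathcal H\cdot)$, $g^{\mathcal V}=g(\mathcal V\cdot,\mathcal V\cdot)$. Let $\sigma,\rho:M\to(0,\infty)$ be smooth, and consider the biconformally changed metric $$\overline g=\sigma^{-2}g^{\mathcal H}+\rho^{-2}g^{\mathcal V}.$$ Let $\tau(\varphi)=\operatorname{trace}_g\nabla d\varphi$ be the tension field of $\varphi:(M,g)\to(N,h)$ and $\overline\tau(\varphi)$ the tension field of $\varphi:(M,\overline g)\to(N,h)$. Then at every point of $M$ $$\overline\tau(\varphi)=\sigma^{2}\left[\tau(\varphi)+d\varphi\big(\operatorname{grad}\ln(\rho^{2n-m}\sigma^{2-2n})\big)\right].$$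 Moreover, if $m>2n$, the mean curvature vector field of the fibres, $$\mu^{\mathcal V}=\frac1{m-2n}\sum_{\alpha}\mathcal H(\nabla_{e_\alpha}e_\alpha)\qquad(\{e_\alpha\}\text{ a local }g\text{-orthonormal frame of }\mathcal V),$$ and the corresponding field $\overline\mu^{\mathcal V}$ for $\overline g$ satisfy $$\overline\mu^{\mathcal V}=\sigma^{2}\left[\mu^{\mathcal V}+\mathcal H(\operatorname{grad}\ln\rho)\right].$$ Here $\nabla$, $\operatorname{grad}$ and the projections on the right-hand sides are those of $g$. -/

import Mathlib

open Manifold Bundle ContDiff Topology Module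

set_option linter.unusedSectionVars false

noncomputable section

namespace Biconformal

/-! ### Linear algebra of inner products and surjections -/

section Linear

variable {V W : Type*} [AddCommGroup V] [Module ℝ V] [TopologicalSpace V]
  [IsTopologicalAddGroup V] [ContinuousSMul ℝ V]
  [AddCommGroup W] [Module ℝ W] [TopologicalSpace W]
  [IsTopologicalAddGroup W] [ContinuousSMul ℝ W]

/-- For an inner product `b` on `V` and a linear map `A : V → W`, the map `W* → V` sending `l` to
the vector `v` with `b(v, ·) = l ∘ A`. -/
def adj (b : V →L[ℝ] V →L[ℝ] ℝ) (A : V →L[ℝ] W) : (W →L[ℝ] ℝ) →L[ℝ] V :=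
  b.inverse ∘L ContinuousLinearMap.precomp ℝ A

/-- For an inner product `b` on `V` and a surjective linear map `A : V → W`, the `b`-orthogonal
projection of `V` onto `(ker A)^⊥`; see `map_horProj`, `horProj_orthogonal` and `eq_horProj`. -/
def horProj (b : V →L[ℝ] V →L[ℝ] ℝ) (A : V →L[ℝ] W) : V →L[ℝ] V :=
  adj b A ∘L (A ∘L adj b A).inverse ∘L A

variable [FiniteDimensional ℝ V] [T2Space V] [FiniteDimensional ℝ W] [T2Space W]

instance : FiniteDimensional ℝ (V →L[ℝ] ℝ) :=
  Module.Finite.equiv (LinearMap.toContinuousLinearMap (𝕜 := ℝ) (E := V) (F' := ℝ))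

theorem finrank_dual : finrank ℝ (V →L[ℝ] ℝ) = finrank ℝ V := by
  rw [← (LinearMap.toContinuousLinearMap (𝕜 := ℝ) (E := V) (F' := ℝ)).finrank_eq]
  exact Subspace.dual_finrank_eq

theorem isInvertible_of_injective (f : V →L[ℝ] W) (hf : Function.Injective f)
    (h : finrank ℝ V = finrank ℝ W) : f.IsInvertible := by
  let e := LinearEquiv.ofInjectiveOfFinrankEq f.toLinearMap hf h
  refine ⟨e.toContinuousLinearEquiv, ?_⟩
  ext v
  rfl

theorem isInvertible_of_pos (b : V →L[ℝ] V →L[ℝ] ℝ) (hb : ∀ v, v ≠ 0 → 0 < b v v) :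
    b.IsInvertible := by
  refine isInvertible_of_injective b ?_ finrank_dual.symm
  rw [injective_iff_map_eq_zero]
  intro v hv
  by_contra h
  have := hb v h
  simp [hv] at this

theorem apply_adj (b : V →L[ℝ] V →L[ℝ] ℝ) (hb : ∀ v, v ≠ 0 → 0 < b v v) (A : V →L[ℝ] W)
    (l : W →L[ℝ] ℝ) (v : V) : b (adj b A l) v = l (A v) := by
  simp only [adj, ContinuousLinearMap.comp_apply]
  rw [(isInvertible_of_pos b hb).self_apply_inverse]
  rfl

theorem isInvertible_comp_adj (b : V →L[ℝ] V →L[ℝ] ℝ) (hb : ∀ v, v ≠ 0 → 0 < b v v)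
    (A : V →L[ℝ] W) (hA : Function.Surjective A) : (A ∘L adj b A).IsInvertible := by
  refine isInvertible_of_injective _ ?_ finrank_dual
  rw [injective_iff_map_eq_zero]
  intro l hl
  have h1 := apply_adj b hb A l (adj b A l)
  have h2 : A (adj b A l) = 0 := hl
  rw [h2, map_zero] at h1
  have h3 : adj b A l = 0 := by
    by_contra h
    exact (hb _ h).ne' h1
  ext w
  obtain ⟨v, rfl⟩ := hA w
  rw [← apply_adj b hb, h3]
  simp

theorem map_horProj (b : V →L[ℝ] V →L[ℝ] ℝ) (hb : ∀ v, v ≠ 0 → 0 < b v v)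
    (A : V →L[ℝ] W) (hA : Function.Surjective A) (v : V) : A (horProj b A v) = A v :=
  (isInvertible_comp_adj b hb A hA).self_apply_inverse (A v)

theorem horProj_orthogonal (b : V →L[ℝ] V →L[ℝ] ℝ) (hb : ∀ v, v ≠ 0 → 0 < b v v)
    (A : V →L[ℝ] W) (v w : V) (hw : A w = 0) : b (horProj b A v) w = 0 := by
  simp only [horProj, ContinuousLinearMap.comp_apply]
  rw [apply_adj b hb, hw, map_zero]

theorem eq_horProj (b : V →L[ℝ] V →L[ℝ] ℝ) (hb : ∀ v, v ≠ 0 → 0 < b v v)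
    (A : V →L[ℝ] W) (hA : Function.Surjective A) (v u : V) (h1 : A u = A v)
    (h2 : ∀ w, A w = 0 → b u w = 0) : u = horProj b A v := by
  by_contra h
  have h3 := hb _ (sub_ne_zero.2 h)
  have h4 : A (u - horProj b A v) = 0 := by rw [map_sub, map_horProj b hb A hA, h1, sub_self]
  have h5 : b (u - horProj b A v) (u - horProj b A v) =
      b u (u - horProj b A v) - b (horProj b A v) (u - horProj b A v) := by
    rw [map_sub b]; rfl
  rw [h5, h2 _ h4, horProj_orthogonal b hb A _ _ h4] at h3
  simp at h3

end Linear

section Linear2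
variable {V W : Type*} [AddCommGroup V] [Module ℝ V] [TopologicalSpace V]
  [IsTopologicalAddGroup V] [ContinuousSMul ℝ V]
  [AddCommGroup W] [Module ℝ W] [TopologicalSpace W]
  [IsTopologicalAddGroup W] [ContinuousSMul ℝ W]

/-- The bilinear form `b(P ·, P ·)`. -/
def pullbackForm (b : V →L[ℝ] V →L[ℝ] ℝ) (P : W →L[ℝ] V) : W →L[ℝ] W →L[ℝ] ℝ :=
  ContinuousLinearMap.precomp ℝ P ∘L b ∘L P

theorem pullbackForm_apply (b : V →L[ℝ] V →L[ℝ] ℝ) (P : W →L[ℝ] V) (u v : W) :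
    pullbackForm b P u v = b (P u) (P v) := rfl

/-- For an inner product `b` and a surjective `A`, the `b`-orthogonal projection onto `ker A`. -/
def verProj (b : V →L[ℝ] V →L[ℝ] ℝ) (A : V →L[ℝ] W) : V →L[ℝ] V :=
  ContinuousLinearMap.id ℝ V - horProj b A

/-- The bilinear form `s⁻² b^H + r⁻² b^V`, where `b^H(u, v) = b(H u, H v)` and
`b^V(u, v) = b(V u, V v)` for the `b`-orthogonal projections `H`, `V` onto `(ker A)^⊥`, `ker A`. -/
def biconformalForm (b : V →L[ℝ] V →L[ℝ] ℝ) (A : V →L[ℝ] W) (s r : ℝ) : V →L[ℝ] V →L[ℝ] ℝ :=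
  (s ^ 2)⁻¹ • pullbackForm b (horProj b A) + (r ^ 2)⁻¹ • pullbackForm b (verProj b A)

theorem biconformalForm_apply (b : V →L[ℝ] V →L[ℝ] ℝ) (A : V →L[ℝ] W) (s r : ℝ) (u v : V) :
    biconformalForm b A s r u v = (s ^ 2)⁻¹ * b (horProj b A u) (horProj b A v) +
      (r ^ 2)⁻¹ * b (u - horProj b A u) (v - horProj b A v) := rfl

theorem nonneg_of_pos (b : V →L[ℝ] V →L[ℝ] ℝ) (hb : ∀ v, v ≠ 0 → 0 < b v v) (v : V) :
    0 ≤ b v v := by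
  rcases eq_or_ne v 0 with rfl | h
  · simp
  · exact (hb v h).le

theorem biconformalForm_pos (b : V →L[ℝ] V →L[ℝ] ℝ) (hb : ∀ v, v ≠ 0 → 0 < b v v)
    (A : V →L[ℝ] W) {s r : ℝ} (hs : 0 < s) (hr : 0 < r) (v : V) (hv : v ≠ 0) :
    0 < biconformalForm b A s r v v := by
  rw [biconformalForm_apply]
  have hs' : 0 < (s ^ 2)⁻¹ := by positivity
  have hr' : 0 < (r ^ 2)⁻¹ := by positivity
  by_cases h : horProj b A v = 0
  · simpa [h] using mul_pos hr' (hb v hv)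
  · exact add_pos_of_pos_of_nonneg (mul_pos hs' (hb _ h)) (mul_nonneg hr'.le (nonneg_of_pos b hb _))

variable [FiniteDimensional ℝ V] [T2Space V] [FiniteDimensional ℝ W] [T2Space W]

/-- The trace `∑ B(e_i, e_i)` (`e` any `b`-orthonormal basis) of a bilinear map `B` with respect to
an inner product `b`, written with an arbitrary basis `e_i` and its `b`-dual basis
`e^i = b⁻¹(e_i^*)` as `∑ B(e_i, e^i)`. -/
def metricTrace (b : V →L[ℝ] V →L[ℝ] ℝ) (B : V → V → W) : W :=
  ∑ i, B (finBasis ℝ V i)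
    (b.inverse (LinearMap.toContinuousLinearMap ((finBasis ℝ V).coord i)))

theorem biconformalForm_bound (b : V →L[ℝ] V →L[ℝ] ℝ) (hb : ∀ v, v ≠ 0 → 0 < b v v)
    (hsymm : ∀ u v, b u v = b v u) (A : V →L[ℝ] W) (hA : Function.Surjective A)
    {s r : ℝ} (hs : 0 < s) (hr : 0 < r) (v : V)
    (hv : biconformalForm b A s r v v < 1) : b v v < s ^ 2 + r ^ 2 := by
  rw [biconformalForm_apply] at hv
  have h1 : A (v - horProj b A v) = 0 := by rw [map_sub, map_horProj b hb A hA, sub_self]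
  have h2 := horProj_orthogonal b hb A v _ h1
  have h3 := hsymm (horProj b A v) (v - horProj b A v)
  have key : b v v = b (horProj b A v) (horProj b A v) +
      b (v - horProj b A v) (v - horProj b A v) := by
    set P := horProj b A v
    set Q := v - P
    have : v = P + Q := by simp [Q]
    have e : b (P + Q) (P + Q) = (b P P + b P Q) + (b Q P + b Q Q) := by
      rw [map_add b]
      change b P (P + Q) + b Q (P + Q) = _
      rw [map_add, map_add]
    rw [this, e, h2, ← h3, h2]; ring
  have hp := nonneg_of_pos b hb (horProj b A v)
  have hq := nonneg_of_pos b hb (v - horProj b A v)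
  rw [key]
  have hs2 : 0 < s ^ 2 := by positivity
  have hr2 : 0 < r ^ 2 := by positivity
  generalize b (horProj b A v) (horProj b A v) = x at *
  generalize b (v - horProj b A v) (v - horProj b A v) = y at *
  have ex : x < s ^ 2 := by
    have : (s ^ 2)⁻¹ * x < 1 := lt_of_le_of_lt (le_add_of_nonneg_right (by positivity)) hv
    rwa [inv_mul_lt_iff₀ hs2, mul_one] at this
  have ey : y < r ^ 2 := by
    have : (r ^ 2)⁻¹ * y < 1 := lt_of_le_of_lt (le_add_of_nonneg_left (by positivity)) hv
    rwa [inv_mul_lt_iff₀ hr2, mul_one] at this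
  linarith

/-- Naturality of the biconformal form under linear isomorphisms. -/
theorem biconformalForm_naturality {V' W' : Type*} [AddCommGroup V'] [Module ℝ V']
    [TopologicalSpace V'] [IsTopologicalAddGroup V'] [ContinuousSMul ℝ V']
    [FiniteDimensional ℝ V'] [T2Space V']
    [AddCommGroup W'] [Module ℝ W'] [TopologicalSpace W']
    [IsTopologicalAddGroup W'] [ContinuousSMul ℝ W'] [FiniteDimensional ℝ W'] [T2Space W']
    (b : V →L[ℝ] V →L[ℝ] ℝ) (hb : ∀ v, v ≠ 0 → 0 < b v v)
    (A : V →L[ℝ] W) (hA : Function.Surjective A) (s r : ℝ)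
    (T : V' ≃L[ℝ] V) (S : W ≃L[ℝ] W') :
    biconformalForm (pullbackForm b (T : V' →L[ℝ] V)) ((S : W →L[ℝ] W') ∘L A ∘L (T : V' →L[ℝ] V))
      s r = pullbackForm (biconformalForm b A s r) (T : V' →L[ℝ] V) := by
  have hb' : ∀ v, v ≠ 0 → 0 < pullbackForm b (T : V' →L[ℝ] V) v v := by
    intro v hv
    exact hb _ (by simpa using hv)
  have hA' : Function.Surjective ((S : W →L[ℝ] W') ∘L A ∘L (T : V' →L[ℝ] V)) :=
    S.surjective.comp (hA.comp T.surjective)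
  have key : ∀ u, horProj (pullbackForm b (T : V' →L[ℝ] V))
      ((S : W →L[ℝ] W') ∘L A ∘L (T : V' →L[ℝ] V)) u = T.symm (horProj b A (T u)) := by
    intro u
    refine (eq_horProj _ hb' _ hA' u _ ?_ ?_).symm
    · simp [map_horProj b hb A hA]
    · intro w hw
      rw [pullbackForm_apply]
      simp only [ContinuousLinearEquiv.coe_coe, ContinuousLinearEquiv.apply_symm_apply]
      refine horProj_orthogonal b hb A _ _ ?_
      simpa using hw
  ext u v
  rw [pullbackForm_apply, biconformalForm_apply, biconformalForm_apply, key, key,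
    pullbackForm_apply, pullbackForm_apply]
  simp

end Linear2

section Smooth

variable {E E' : Type*} [NormedAddCommGroup E] [NormedSpace ℝ E] [FiniteDimensional ℝ E]
  [NormedAddCommGroup E'] [NormedSpace ℝ E'] [FiniteDimensional ℝ E']

theorem contDiffAt_of_apply {D F : Type*} [NormedAddCommGroup D] [NormedSpace ℝ D]
    [NormedAddCommGroup F] [NormedSpace ℝ F] {f : D → E →L[ℝ] F} {x : D}
    (h : ∀ y, ContDiffAt ℝ ∞ (fun z => f z y) x) : ContDiffAt ℝ ∞ f x := by
  let e₁ := ContinuousLinearEquiv.ofFinrankEq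
    (finrank_fin_fun ℝ (n := finrank ℝ E)).symm
  let e₂ := (e₁.arrowCongr (1 : F ≃L[ℝ] F)).trans (ContinuousLinearEquiv.piRing (Fin (finrank ℝ E)))
  rw [← Function.id_comp f, ← e₂.symm_comp_self]
  exact e₂.symm.contDiff.contDiffAt.comp x (contDiffAt_pi.mpr fun i => h _)

theorem contDiffAt_biconformalForm (b : E →L[ℝ] E →L[ℝ] ℝ) (hb : ∀ v, v ≠ 0 → 0 < b v v)
    (A : E →L[ℝ] E') (hA : Function.Surjective A) {s r : ℝ} (hs : 0 < s) (hr : 0 < r) :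
    ContDiffAt ℝ ∞ (fun z : (E →L[ℝ] E →L[ℝ] ℝ) × (E →L[ℝ] E') × ℝ × ℝ =>
      biconformalForm z.1 z.2.1 z.2.2.1 z.2.2.2) (b, A, s, r) := by
  have : CompleteSpace E := FiniteDimensional.complete ℝ E
  have : CompleteSpace E' := FiniteDimensional.complete ℝ E'
  have hpre' : ContDiff ℝ ∞
      (fun P : E →L[ℝ] E' => (ContinuousLinearMap.precomp ℝ P : (E' →L[ℝ] ℝ) →L[ℝ] (E →L[ℝ] ℝ))) :=
    contDiff_clm_apply_iff.2 fun l => (contDiff_const (c := l)).clm_comp contDiff_id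
  have hadj : ContDiffAt ℝ ∞ (fun z : (E →L[ℝ] E →L[ℝ] ℝ) × (E →L[ℝ] E') × ℝ × ℝ =>
      adj z.1 z.2.1) (b, A, s, r) := by
    unfold adj
    refine ContDiffAt.clm_comp ?_ ?_
    · exact ContDiffAt.comp (b, A, s, r) (f := fun z : (E →L[ℝ] E →L[ℝ] ℝ) × (E →L[ℝ] E') × ℝ × ℝ => z.1)
        (isInvertible_of_pos b hb).contDiffAt_map_inverse contDiffAt_fst
    · exact hpre'.contDiffAt.comp _ (contDiff_snd.fst).contDiffAt
  have hA1 : ContDiffAt ℝ ∞ (fun z : (E →L[ℝ] E →L[ℝ] ℝ) × (E →L[ℝ] E') × ℝ × ℝ =>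
      z.2.1) (b, A, s, r) := (contDiff_snd.fst).contDiffAt
  have hhor : ContDiffAt ℝ ∞ (fun z : (E →L[ℝ] E →L[ℝ] ℝ) × (E →L[ℝ] E') × ℝ × ℝ =>
      horProj z.1 z.2.1) (b, A, s, r) := by
    unfold horProj
    refine hadj.clm_comp (ContDiffAt.clm_comp ?_ hA1)
    exact ContDiffAt.comp (b, A, s, r)
      (f := fun z : (E →L[ℝ] E →L[ℝ] ℝ) × (E →L[ℝ] E') × ℝ × ℝ => z.2.1 ∘L adj z.1 z.2.1)
      (isInvertible_comp_adj b hb A hA).contDiffAt_map_inverse (hA1.clm_comp hadj)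
  have hver : ContDiffAt ℝ ∞ (fun z : (E →L[ℝ] E →L[ℝ] ℝ) × (E →L[ℝ] E') × ℝ × ℝ =>
      verProj z.1 z.2.1) (b, A, s, r) := by
    unfold verProj
    exact contDiffAt_const.sub hhor
  have hs' : ContDiffAt ℝ ∞ (fun z : (E →L[ℝ] E →L[ℝ] ℝ) × (E →L[ℝ] E') × ℝ × ℝ =>
      (z.2.2.1 ^ 2)⁻¹) (b, A, s, r) :=
    ContDiffAt.inv ((contDiff_snd.snd.fst).contDiffAt.pow 2) (by simpa using hs.ne')
  have hr' : ContDiffAt ℝ ∞ (fun z : (E →L[ℝ] E →L[ℝ] ℝ) × (E →L[ℝ] E') × ℝ × ℝ =>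
      (z.2.2.2 ^ 2)⁻¹) (b, A, s, r) :=
    ContDiffAt.inv ((contDiff_snd.snd.snd).contDiffAt.pow 2) (by simpa using hr.ne')
  have hpull' : ∀ P : (E →L[ℝ] E →L[ℝ] ℝ) × (E →L[ℝ] E') × ℝ × ℝ → (E →L[ℝ] E),
      ContDiffAt ℝ ∞ P (b, A, s, r) → ∀ u v,
      ContDiffAt ℝ ∞ (fun z => z.1 (P z u) (P z v)) (b, A, s, r) := fun P hP u v =>
    (contDiffAt_fst.clm_apply (hP.clm_apply contDiffAt_const)).clm_apply
      (hP.clm_apply contDiffAt_const)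
  refine contDiffAt_of_apply fun u => contDiffAt_of_apply fun v => ?_
  exact (hs'.mul (hpull' _ hhor u v)).add (hr'.mul (hpull' _ hver u v))

end Smooth

section Manifold

/-- Smooth Riemannian metrics on the manifold `M` modelled on the vector space `E`. -/
abbrev Metric (E M : Type*) [NormedAddCommGroup E] [NormedSpace ℝ E] [TopologicalSpace M]
    [ChartedSpace E M] [IsManifold 𝓘(ℝ, E) ∞ M] : Type _ :=
  ContMDiffRiemannianMetric 𝓘(ℝ, E) ∞ E (fun p : M => TangentSpace 𝓘(ℝ, E) p)

variable {E : Type*} [NormedAddCommGroup E] [NormedSpace ℝ E] [FiniteDimensional ℝ E]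
  {M : Type*} [TopologicalSpace M] [ChartedSpace E M]
  {E' : Type*} [NormedAddCommGroup E'] [NormedSpace ℝ E'] [FiniteDimensional ℝ E']
  {N : Type*} [TopologicalSpace N] [ChartedSpace E' N]

instance (p : M) : FiniteDimensional ℝ (TangentSpace 𝓘(ℝ, E) p) :=
  inferInstanceAs (FiniteDimensional ℝ E)

instance (p : M) : T2Space (TangentSpace 𝓘(ℝ, E) p) :=
  inferInstanceAs (T2Space E)

variable [IsManifold 𝓘(ℝ, E) ∞ M] [IsManifold 𝓘(ℝ, E') ∞ N]

/-! ### The Levi-Civita connection -/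

/-- The derivative at `q` of the chart around `p`, as a map from `T_q M` to the model space. -/
def toChart (p q : M) : TangentSpace 𝓘(ℝ, E) q →L[ℝ] E :=
  (trivializationAt E (TangentSpace 𝓘(ℝ, E) : M → Type _) p).continuousLinearMapAt ℝ q

/-- The inverse of `toChart p q`: `v` is sent to the vector at `q` with coordinates `v` in the
chart around `p`. -/
def ofChart (p q : M) : E →L[ℝ] TangentSpace 𝓘(ℝ, E) q :=
  (trivializationAt E (TangentSpace 𝓘(ℝ, E) : M → Type _) p).symmL ℝ q

/-- The metric in the chart around `p`. -/
def chartMetric (g : Metric E M) (p : M) (y : E) : E →L[ℝ] E →L[ℝ] ℝ :=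
  pullbackForm (g.inner ((extChartAt 𝓘(ℝ, E) p).symm y))
    (ofChart p ((extChartAt 𝓘(ℝ, E) p).symm y))

/-- The Christoffel symbols `Γ(u, v)` at `p` in the chart around `p`:
`G(Γ(u, v), z) = 1/2 (∂_u G(v, z) + ∂_v G(u, z) - ∂_z G(u, v))`. -/
def christoffel (g : Metric E M) (p : M) (u v : E) : E :=
  let dG := fderiv ℝ (chartMetric g p) (extChartAt 𝓘(ℝ, E) p p)
  (chartMetric g p (extChartAt 𝓘(ℝ, E) p p)).inverse
    ((1 / 2 : ℝ) • (dG u v + dG v u - (dG.flip u).flip v))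

/-- For a map `φ : M → N`, the pull-back to `φ^* TN` of the Levi-Civita connection of `h`:
the covariant derivative at `p`, in the direction `u`, of the vector field `s` along `φ`.
In the chart around `φ p` it is `∂_u s + Γ(dφ u, s)`. -/
def covDerivAlong (h : Metric E' N) (φ : M → N) (s : ∀ q : M, TangentSpace 𝓘(ℝ, E') (φ q)) (p : M)
    (u : TangentSpace 𝓘(ℝ, E) p) : TangentSpace 𝓘(ℝ, E') (φ p) :=
  ofChart (φ p) (φ p)
    (mvfderiv 𝓘(ℝ, E) (fun q => toChart (φ p) (φ q) (s q)) p u +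
      christoffel h (φ p) (toChart (φ p) (φ p) (mfderiv 𝓘(ℝ, E) 𝓘(ℝ, E') φ p u))
        (toChart (φ p) (φ p) (s p)))

/-- The Levi-Civita connection: `leviCivita g Y p u` is `∇_u Y` at `p`. -/
def leviCivita (g : Metric E M) (Y : ∀ q : M, TangentSpace 𝓘(ℝ, E) q) (p : M)
    (u : TangentSpace 𝓘(ℝ, E) p) : TangentSpace 𝓘(ℝ, E) p :=
  covDerivAlong g (fun q : M => q) Y p u

/-- The gradient of a function. -/
def grad (g : Metric E M) (f : M → ℝ) (p : M) : TangentSpace 𝓘(ℝ, E) p :=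
  (g.inner p).inverse (mvfderiv 𝓘(ℝ, E) f p)

/-! ### The tension field and the mean curvature of the fibres -/

/-- The second fundamental form `∇dφ(u, v) = ∇^φ_u (dφ Y) - dφ(∇_u Y)` of `φ` at `p`, where `Y` is a
vector field, smooth near `p`, that extends `v` (the value does not depend on the extension). -/
def hessianMap (g : Metric E M) (h : Metric E' N) (φ : M → N) (p : M)
    (u v : TangentSpace 𝓘(ℝ, E) p) : TangentSpace 𝓘(ℝ, E') (φ p) :=
  covDerivAlong h φ
      (fun q => mfderiv 𝓘(ℝ, E) 𝓘(ℝ, E') φ q (FiberBundle.extend E v q)) p u -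
    mfderiv 𝓘(ℝ, E) 𝓘(ℝ, E') φ p (leviCivita g (FiberBundle.extend E v) p u)

/-- The tension field `τ(φ) = trace_g ∇dφ`. -/
def tensionField (g : Metric E M) (h : Metric E' N) (φ : M → N) (p : M) :
    TangentSpace 𝓘(ℝ, E') (φ p) :=
  metricTrace (g.inner p) (hessianMap g h φ p)

/-- The orthogonal projection of `T_p M` onto the horizontal space `(ker dφ_p)^⊥`. -/
def horizontal (g : Metric E M) (φ : M → N) (p : M) :
    TangentSpace 𝓘(ℝ, E) p →L[ℝ] TangentSpace 𝓘(ℝ, E) p :=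
  horProj (g.inner p) (mfderiv 𝓘(ℝ, E) 𝓘(ℝ, E') φ p)

/-- The orthogonal projection of `T_p M` onto the vertical space `ker dφ_p`. -/
def vertical (g : Metric E M) (φ : M → N) (p : M) :
    TangentSpace 𝓘(ℝ, E) p →L[ℝ] TangentSpace 𝓘(ℝ, E) p :=
  verProj (g.inner p) (mfderiv 𝓘(ℝ, E) 𝓘(ℝ, E') φ p)

/-- The second fundamental form of the fibres of `φ`, precomposed with the vertical projection:
`(u, v)` is sent to `H(∇_{V u} Y)` where `Y` is a vertical vector field extending `V v`. -/
def fibreSecondForm (g : Metric E M) (φ : M → N) (p : M) (u v : TangentSpace 𝓘(ℝ, E) p) :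
    TangentSpace 𝓘(ℝ, E) p :=
  horizontal (E' := E') g φ p
    (leviCivita g (fun q => vertical (E' := E') g φ q (FiberBundle.extend E v q)) p (vertical (E' := E') g φ p u))

/-- The mean curvature `μ^V` of the fibres: the trace `∑_α H(∇_{e_α} e_α)` of their second
fundamental form (`e_α` a vertical orthonormal frame) divided by their dimension. -/
def meanCurvature (g : Metric E M) (φ : M → N) (p : M) : TangentSpace 𝓘(ℝ, E) p :=
  (finrank ℝ (LinearMap.ker (mfderiv 𝓘(ℝ, E) 𝓘(ℝ, E') φ p).toLinearMap) : ℝ)⁻¹ •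
    metricTrace (g.inner p) (fibreSecondForm (E' := E') g φ p)

/-! ### Kähler structures and pseudo horizontal weak conformality -/

/-- `(N, J, h)` is a Kähler manifold: `J` is a smooth almost complex structure, `h` is Hermitian,
and `J` is parallel for the Levi-Civita connection, `∇_u (J Y) = J (∇_u Y)`. -/
structure IsKahler (h : Metric E' N)
    (J : ∀ y : N, TangentSpace 𝓘(ℝ, E') y →L[ℝ] TangentSpace 𝓘(ℝ, E') y) : Prop where
  smooth : ContMDiff 𝓘(ℝ, E') (𝓘(ℝ, E').prod 𝓘(ℝ, E' →L[ℝ] E')) ∞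
    (fun y => TotalSpace.mk' (E' →L[ℝ] E')
      (E := fun y : N => TangentSpace 𝓘(ℝ, E') y →L[ℝ] TangentSpace 𝓘(ℝ, E') y) y (J y))
  sq : ∀ y v, J y (J y v) = -v
  hermitian : ∀ y v w, h.inner y (J y v) (J y w) = h.inner y v w
  parallel : ∀ (Y : ∀ y : N, TangentSpace 𝓘(ℝ, E') y) (y : N),
    MDifferentiableAt 𝓘(ℝ, E') 𝓘(ℝ, E').tangent
      (fun z => (TotalSpace.mk' E' z (Y z) : TangentBundle 𝓘(ℝ, E') N)) y →
    ∀ u, leviCivita h (fun z => J z (Y z)) y u = J y (leviCivita h Y y u)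

/-- The adjoint `dφ_p^* : T_{φ p} N → T_p M` of `dφ_p` with respect to `g` and `h`. -/
def mfderivAdjoint (g : Metric E M) (h : Metric E' N) (φ : M → N) (p : M) :
    TangentSpace 𝓘(ℝ, E') (φ p) →L[ℝ] TangentSpace 𝓘(ℝ, E) p :=
  adj (g.inner p) (mfderiv 𝓘(ℝ, E) 𝓘(ℝ, E') φ p) ∘L h.inner (φ p)

/-- Pseudo horizontal weak conformality: `[dφ ∘ dφ^*, J] = 0`. -/
def IsPHWC (g : Metric E M) (h : Metric E' N)
    (J : ∀ y : N, TangentSpace 𝓘(ℝ, E') y →L[ℝ] TangentSpace 𝓘(ℝ, E') y) (φ : M → N) : Prop :=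
  ∀ p, mfderiv 𝓘(ℝ, E) 𝓘(ℝ, E') φ p ∘L mfderivAdjoint g h φ p ∘L J (φ p) =
    J (φ p) ∘L mfderiv 𝓘(ℝ, E) 𝓘(ℝ, E') φ p ∘L mfderivAdjoint g h φ p

/-! ### Biconformal changes of metric -/

/-- The biconformal change `σ⁻² g^H + ρ⁻² g^V` of the metric `g` with respect to the vertical
and horizontal distributions of the submersion `φ`. -/
def biconformalChange (g : Metric E M) (φ : M → N) (σ ρ : M → ℝ)
    (hφ : ContMDiff 𝓘(ℝ, E) 𝓘(ℝ, E') ∞ φ)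
    (hsub : ∀ x, Function.Surjective (mfderiv 𝓘(ℝ, E) 𝓘(ℝ, E') φ x))
    (hσ : ContMDiff 𝓘(ℝ, E) 𝓘(ℝ, ℝ) ∞ σ) (hσ0 : ∀ x, 0 < σ x)
    (hρ : ContMDiff 𝓘(ℝ, E) 𝓘(ℝ, ℝ) ∞ ρ) (hρ0 : ∀ x, 0 < ρ x) : Metric E M where
  inner x := biconformalForm (g.inner x) (mfderiv 𝓘(ℝ, E) 𝓘(ℝ, E') φ x) (σ x) (ρ x)
  symm x u v := by
    rw [biconformalForm_apply, biconformalForm_apply, g.symm x (horProj _ _ u),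
      g.symm x (u - _)]
  pos x v hv := biconformalForm_pos _ (g.pos x) _ (hσ0 x) (hρ0 x) v hv
  isVonNBounded x := by
    have h1 := g.isVonNBounded x
    have hc : 0 < σ x ^ 2 + ρ x ^ 2 := by have := hσ0 x; positivity
    have h2 := h1.image ((Real.sqrt (σ x ^ 2 + ρ x ^ 2)) •
      ContinuousLinearMap.id ℝ (TangentSpace 𝓘(ℝ, E) x))
    refine h2.subset ?_
    intro v hv
    have h3 := biconformalForm_bound _ (g.pos x) (g.symm x) _ (hsub x) (hσ0 x) (hρ0 x) v hv
    have hs : Real.sqrt (σ x ^ 2 + ρ x ^ 2) ≠ 0 := (Real.sqrt_pos.2 hc).ne'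
    refine ⟨(Real.sqrt (σ x ^ 2 + ρ x ^ 2))⁻¹ • v, ?_, ?_⟩
    · simp only [Set.mem_ofPred_eq, map_smul, smul_apply, smul_eq_mul]
      rw [← mul_assoc, ← mul_inv, Real.mul_self_sqrt hc.le, inv_mul_lt_iff₀ hc, mul_one]
      exact h3
    · simp [hs]
  contMDiff := by
    intro p
    rw [contMDiffAt_hom_bundle]
    refine ⟨contMDiffAt_id, ?_⟩
    have hg := ((contMDiffAt_hom_bundle _).1 (g.contMDiff p)).2
    have hA := (hφ p).mfderiv_const (m := ∞) le_rfl
    -- In trivializations, the new metric is a smooth function of `g`, `dφ`, `σ` and `ρ`.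
    set tM := trivializationAt E (TangentSpace 𝓘(ℝ, E) : M → Type _) p with htM
    set tN := trivializationAt E' (TangentSpace 𝓘(ℝ, E') : N → Type _) (φ p) with htN
    have hMp : p ∈ tM.baseSet := FiberBundle.mem_baseSet_trivializationAt' p
    have hNp : φ p ∈ tN.baseSet := FiberBundle.mem_baseSet_trivializationAt' (φ p)
    have hGeq : ∀ q (hq : q ∈ tM.baseSet) (b : TangentSpace 𝓘(ℝ, E) q →L[ℝ]
        TangentSpace 𝓘(ℝ, E) q →L[ℝ] ℝ),
        ContinuousLinearMap.inCoordinates E (TangentSpace 𝓘(ℝ, E)) (E →L[ℝ] ℝ)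
          (fun q : M => TangentSpace 𝓘(ℝ, E) q →L[ℝ] ℝ) p q p q b =
        pullbackForm b ((tM.continuousLinearEquivAt ℝ q hq).symm : E →L[ℝ] _) := by
      intro q hq b
      ext u v
      rw [pullbackForm_apply]
      have := inCoordinates_apply_eq₂ (F₁ := E) (E₁ := (TangentSpace 𝓘(ℝ, E) : M → Type _))
        (F₂ := E) (E₂ := (TangentSpace 𝓘(ℝ, E) : M → Type _)) (F₃ := ℝ)
        (E₃ := Bundle.Trivial M ℝ) (x₀ := p) (ϕ := b) (v := u) (w := v) hq hq (Set.mem_univ q)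
      rw [← htM] at this
      simpa using this
    have hAeq : ∀ q (hq : q ∈ tM.baseSet) (hq' : φ q ∈ tN.baseSet),
        inTangentCoordinates 𝓘(ℝ, E) 𝓘(ℝ, E') id φ (mfderiv 𝓘(ℝ, E) 𝓘(ℝ, E') φ) p q =
        (tN.continuousLinearEquivAt ℝ (φ q) hq' : _ →L[ℝ] E') ∘L
          (mfderiv 𝓘(ℝ, E) 𝓘(ℝ, E') φ q) ∘L
          ((tM.continuousLinearEquivAt ℝ q hq).symm : E →L[ℝ] _) := by
      intro q hq hq'
      exact ContinuousLinearMap.inCoordinates_eq hq hq'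
    have hform : ∀ q (hq : q ∈ tM.baseSet) (hq' : φ q ∈ tN.baseSet),
        ContinuousLinearMap.inCoordinates E (TangentSpace 𝓘(ℝ, E)) (E →L[ℝ] ℝ)
          (fun q : M => TangentSpace 𝓘(ℝ, E) q →L[ℝ] ℝ) p q p q
          (biconformalForm (g.inner q) (mfderiv 𝓘(ℝ, E) 𝓘(ℝ, E') φ q) (σ q) (ρ q)) =
        biconformalForm
          (ContinuousLinearMap.inCoordinates E (TangentSpace 𝓘(ℝ, E)) (E →L[ℝ] ℝ)
            (fun q : M => TangentSpace 𝓘(ℝ, E) q →L[ℝ] ℝ) p q p q (g.inner q))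
          (inTangentCoordinates 𝓘(ℝ, E) 𝓘(ℝ, E') id φ (mfderiv 𝓘(ℝ, E) 𝓘(ℝ, E') φ) p q)
          (σ q) (ρ q) := by
      intro q hq hq'
      rw [hGeq q hq, hGeq q hq, hAeq q hq hq']
      exact (biconformalForm_naturality (g.inner q) (g.pos q) _ (hsub q) (σ q) (ρ q) _ _).symm
    have hcd := contDiffAt_biconformalForm
      (ContinuousLinearMap.inCoordinates E (TangentSpace 𝓘(ℝ, E)) (E →L[ℝ] ℝ)
          (fun q : M => TangentSpace 𝓘(ℝ, E) q →L[ℝ] ℝ) p p p p (g.inner p))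
      (by
        intro v hv
        rw [hGeq p hMp]
        refine g.pos p _ ?_
        intro h0
        exact hv ((tM.continuousLinearEquivAt ℝ p hMp).symm.map_eq_zero_iff.1 h0))
      (inTangentCoordinates 𝓘(ℝ, E) 𝓘(ℝ, E') id φ (mfderiv 𝓘(ℝ, E) 𝓘(ℝ, E') φ) p p)
      (by
        rw [hAeq p hMp hNp]
        exact (tN.continuousLinearEquivAt ℝ (φ p) hNp).surjective.comp
          ((hsub p).comp (tM.continuousLinearEquivAt ℝ p hMp).symm.surjective))
      (hσ0 p) (hρ0 p)
    have hcomp := ContDiffAt.comp_contMDiffAt (x := p) hcd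
      (hg.prodMk_space (hA.prodMk_space ((hσ p).prodMk_space (hρ p))))
    refine hcomp.congr_of_eventuallyEq ?_
    have e1 : ∀ᶠ q in 𝓝 p, q ∈ tM.baseSet := tM.open_baseSet.mem_nhds hMp
    have e2 : ∀ᶠ q in 𝓝 p, φ q ∈ tN.baseSet :=
      (hφ p).continuousAt.eventually (tN.open_baseSet.mem_nhds hNp)
    filter_upwards [e1, e2] with q h1 h2
    exact hform q h1 h2


end Manifold

end Biconformal

end

noncomputable section

set_option synthInstance.maxHeartbeats 200000

namespace Biconformal

/-! ### Traces with respect to an inner product and its biconformal change. -/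

section Trace

variable {V W : Type*} [AddCommGroup V] [Module ℝ V] [TopologicalSpace V]
  [IsTopologicalAddGroup V] [ContinuousSMul ℝ V]
  [AddCommGroup W] [Module ℝ W] [TopologicalSpace W]
  [IsTopologicalAddGroup W] [ContinuousSMul ℝ W]
  [FiniteDimensional ℝ V] [T2Space V] [FiniteDimensional ℝ W] [T2Space W]

/-! The metric of `M` enters `∇dφ(u, v) = ∇^φ_u (dφ Y) - dφ(∇_u Y)` only through the last term. So a
change of metric alters `∇dφ` by minus `dφ` of the difference of the two Levi-Civita connections.
Since `dφ` kills the vertical part, this image is determined by pairing with horizontal `z`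
(`map_eq_zero_of_apply_horProj_eq_zero`), and the pairing is given by the Koszul formula. In the
charts around `p` and `φ p` this is first order calculus at one point, for a field `G` of inner
products and the derivative `A` of a submersion (`IsBiconformalData`).

The trace for the new metric is `σ²` times the horizontal trace plus `ρ²` times the vertical trace
for the old one (`metricTrace_biconformalForm`), so mixed arguments never matter and two cases
remain.

Horizontal `u`, `v` (`christoffel_horizontal`): the vertical part of the metric is quadratic in
vertical components, so to first order it is invisible to vectors that are horizontal at the point.
The metric behaves as under the conformal change `σ⁻² g`, and with `l = d ln σ` the form `∇dφ` gains
`l(u) dφ v + l(v) dφ u - g(u, v) dφ(grad ln σ)`. Its horizontal trace is `(2 - 2n) dφ(grad ln σ)`.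

Vertical `u`, `v` (`christoffel_vertical`): the horizontal part of the metric is the pull-back under
`A` of a form `k` on the target, so its derivative involves `∂A`, which is symmetric. The outcome is
`ρ² ∇dφ_new = σ² (∇dφ - g(u, v) dφ(grad ln ρ))`, with trace term `(2n - m) dφ(grad ln ρ)`. Adding
the two traces gives the tension field (`metricTrace_biconformal_change`).

For the fibres, differentiating `dφ(Y) = 0` for a vertical field `Y` shows that `dφ` maps their
second fundamental form to `-∇dφ` on vertical vectors. The vertical case, traced and lifted
horizontally, gives the mean curvature; the factor `m - 2n` in front of `grad ln ρ` cancels the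
normalisation (`metricTrace_fibre_change`). -/

theorem apply_inverse_apply (b : V →L[ℝ] V →L[ℝ] ℝ) (hb : ∀ v, v ≠ 0 → 0 < b v v)
    (l : V →L[ℝ] ℝ) (v : V) : b (b.inverse l) v = l v := by
  rw [(isInvertible_of_pos b hb).self_apply_inverse]

theorem eq_of_forall_apply_eq (b : V →L[ℝ] V →L[ℝ] ℝ) (hb : ∀ v, v ≠ 0 → 0 < b v v)
    {u v : V} (h : ∀ z, b u z = b v z) : u = v := by
  by_contra hne
  have h1 := hb _ (sub_ne_zero.2 hne)
  rw [map_sub b, sub_apply, h, sub_self] at h1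
  exact lt_irrefl _ h1

theorem metricTrace_add (b : V →L[ℝ] V →L[ℝ] ℝ) (B C : V → V → W) :
    metricTrace b (fun u v => B u v + C u v) = metricTrace b B + metricTrace b C :=
  Finset.sum_add_distrib

theorem metricTrace_sub (b : V →L[ℝ] V →L[ℝ] ℝ) (B C : V → V → W) :
    metricTrace b (fun u v => B u v - C u v) = metricTrace b B - metricTrace b C :=
  Finset.sum_sub_distrib _ _

theorem metricTrace_map {W' : Type*} [AddCommGroup W'] [Module ℝ W'] [TopologicalSpace W']
    [IsTopologicalAddGroup W'] [ContinuousSMul ℝ W'] [FiniteDimensional ℝ W'] [T2Space W']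
    (b : V →L[ℝ] V →L[ℝ] ℝ) (L : W →ₗ[ℝ] W') (B : V → V → W) :
    metricTrace b (fun u v => L (B u v)) = L (metricTrace b B) :=
  (map_sum L _ _).symm

theorem metricTrace_smul (b : V →L[ℝ] V →L[ℝ] ℝ) (c : ℝ) (B : V → V → W) :
    metricTrace b (fun u v => c • B u v) = c • metricTrace b B :=
  Finset.smul_sum.symm

theorem metricTrace_smul_const (b : V →L[ℝ] V →L[ℝ] ℝ) (f : V → V → ℝ) (w : W) :
    metricTrace b (fun u v => f u v • w) = metricTrace b f • w :=
  Finset.sum_smul.symm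

/-- This replaces the choice of an adapted orthonormal basis: if `T e_i = ∑ t_ji e_j`, then the
adjoint acts on the dual basis by the transposed matrix, `T' e^j = ∑ t_ji e^i`, and both traces
become the same double sum. -/
theorem metricTrace_comp_left (b : V →L[ℝ] V →L[ℝ] ℝ) (hb : ∀ v, v ≠ 0 → 0 < b v v)
    (hsymm : ∀ u v, b u v = b v u) (B : V →ₗ[ℝ] V →ₗ[ℝ] W) (T T' : V →L[ℝ] V)
    (hT : ∀ u v, b (T u) v = b u (T' v)) :
    metricTrace b (fun u v => B (T u) v) = metricTrace b (fun u v => B u (T' v)) := by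
  unfold metricTrace
  set f := finBasis ℝ V
  have h1 : ∀ i, T (f i) = ∑ j, f.coord j (T (f i)) • f j := fun i => (f.sum_repr _).symm
  have h2 : ∀ j, T' (b.inverse (LinearMap.toContinuousLinearMap (f.coord j))) =
      ∑ i, f.coord j (T (f i)) • b.inverse (LinearMap.toContinuousLinearMap (f.coord i)) := by
    intro j
    refine eq_of_forall_apply_eq b hb fun z => ?_
    rw [hsymm, ← hT, hsymm, apply_inverse_apply b hb]
    simp only [map_sum, map_smul, sum_apply, smul_apply,
      apply_inverse_apply b hb]
    conv_lhs => rw [← f.sum_repr z, map_sum, map_sum]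
    simp [mul_comm]
  simp_rw [h2]
  conv_lhs => enter [2, i]; rw [h1]
  simp only [map_sum, map_smul, LinearMap.sum_apply, LinearMap.smul_apply]
  exact Finset.sum_comm

theorem metricTrace_form (b : V →L[ℝ] V →L[ℝ] ℝ) (hb : ∀ v, v ≠ 0 → 0 < b v v)
    (hsymm : ∀ u v, b u v = b v u) (T : V →L[ℝ] V) :
    metricTrace b (fun u v => b (T u) v) = LinearMap.trace ℝ V (T : V →ₗ[ℝ] V) := by
  rw [LinearMap.trace_eq_matrix_trace ℝ (finBasis ℝ V)]
  refine Finset.sum_congr rfl fun i _ => ?_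
  beta_reduce
  rw [hsymm, apply_inverse_apply b hb]
  simp [LinearMap.toMatrix_apply]

theorem metricTrace_smul_right (b : V →L[ℝ] V →L[ℝ] ℝ) (hb : ∀ v, v ≠ 0 → 0 < b v v)
    (l : V →L[ℝ] ℝ) : metricTrace b (fun u v => l u • v) = b.inverse l := by
  refine eq_of_forall_apply_eq b hb fun z => ?_
  rw [apply_inverse_apply b hb]
  unfold metricTrace
  simp only [map_sum, map_smul, sum_apply, smul_apply,
      apply_inverse_apply b hb]
  conv_rhs => rw [← (finBasis ℝ V).sum_repr z, map_sum]
  simp [mul_comm]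

theorem metricTrace_smul_left (b : V →L[ℝ] V →L[ℝ] ℝ) (hb : ∀ v, v ≠ 0 → 0 < b v v)
    (hsymm : ∀ u v, b u v = b v u)
    (l : V →L[ℝ] ℝ) : metricTrace b (fun u v => l v • u) = b.inverse l := by
  unfold metricTrace
  conv_rhs => rw [← (finBasis ℝ V).sum_repr (b.inverse l)]
  refine Finset.sum_congr rfl fun i _ => ?_
  beta_reduce
  rw [← apply_inverse_apply b hb l, hsymm, apply_inverse_apply b hb]
  rfl

variable (b : V →L[ℝ] V →L[ℝ] ℝ) (hb : ∀ v, v ≠ 0 → 0 < b v v)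
  (hsymm : ∀ u v, b u v = b v u) (A : V →L[ℝ] W) (hA : Function.Surjective A)

include hb hA in
theorem horProj_horProj (v : V) : horProj b A (horProj b A v) = horProj b A v :=
  (eq_horProj b hb A hA _ _ rfl fun w hw => horProj_orthogonal b hb A v w hw).symm

include hb hA in
theorem map_sub_horProj (v : V) : A (v - horProj b A v) = 0 := by
  rw [map_sub, map_horProj b hb A hA, sub_self]

include hb hA in
theorem apply_horProj_horProj (u v : V) :
    b (horProj b A u) (horProj b A v) = b (horProj b A u) v := by
  have := horProj_orthogonal b hb A u _ (map_sub_horProj b hb A hA v)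
  rw [map_sub, sub_eq_zero] at this
  exact this.symm

include hb hsymm hA in
theorem apply_horProj_left (u v : V) : b (horProj b A u) v = b u (horProj b A v) := by
  rw [← apply_horProj_horProj b hb A hA, hsymm, apply_horProj_horProj b hb A hA, hsymm]

include hb hA in
-- Cyclicity of the trace: moving `A` to the front of `adj b A ∘ (A ∘ adj b A)⁻¹ ∘ A` leaves the
-- identity of `W`.
theorem trace_horProj :
    LinearMap.trace ℝ V (horProj b A : V →ₗ[ℝ] V) = finrank ℝ W := by
  have h1 : ((horProj b A : V →L[ℝ] V) : V →ₗ[ℝ] V) =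
      (adj b A ∘L (A ∘L adj b A).inverse).toLinearMap ∘ₗ A.toLinearMap := rfl
  rw [h1, LinearMap.trace_comp_comm', ← LinearMap.trace_id]
  congr 1
  ext w
  exact (isInvertible_comp_adj b hb A hA).self_apply_inverse w

include hb hsymm hA in
theorem inverse_biconformalForm {s r : ℝ} (hs : 0 < s) (hr : 0 < r) (l : V →L[ℝ] ℝ) :
    (biconformalForm b A s r).inverse l =
      s ^ 2 • horProj b A (b.inverse l) + r ^ 2 • (b.inverse l - horProj b A (b.inverse l)) := by
  have hpos := biconformalForm_pos b hb A hs hr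
  refine eq_of_forall_apply_eq _ hpos fun z => ?_
  rw [apply_inverse_apply _ hpos, biconformalForm_apply]
  set w := b.inverse l
  have e : horProj b A (s ^ 2 • horProj b A w + r ^ 2 • (w - horProj b A w)) =
      s ^ 2 • horProj b A w := by
    simp [horProj_horProj b hb A hA]
  rw [e]
  simp only [add_sub_cancel_left, map_smul, smul_apply, smul_eq_mul]
  rw [inv_mul_cancel_left₀ (by positivity), inv_mul_cancel_left₀ (by positivity),
    apply_horProj_horProj b hb A hA]
  have h2 : b (w - horProj b A w) (z - horProj b A z) = b (w - horProj b A w) z := by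
    rw [map_sub, map_sub b, sub_apply, sub_apply, apply_horProj_horProj b hb A hA,
      apply_horProj_left b hb hsymm A hA w z]
    simp
  rw [h2, map_sub b, sub_apply, apply_inverse_apply b hb]
  ring

include hb hsymm hA in
-- The inverse of the changed form multiplies the horizontal part of a dual basis vector by `s ^ 2`
-- and the vertical part by `r ^ 2`. The projections are self-adjoint and idempotent, so a
-- projection on the second argument may be copied to the first under the trace, which removes the
-- mixed terms.
theorem metricTrace_biconformalForm {X : Type*} [AddCommGroup X] [Module ℝ X] [TopologicalSpace X]
    [IsTopologicalAddGroup X] [ContinuousSMul ℝ X] [FiniteDimensional ℝ X] [T2Space X]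
    {s r : ℝ} (hs : 0 < s) (hr : 0 < r)
    (B : V →ₗ[ℝ] V →ₗ[ℝ] X) :
    metricTrace (biconformalForm b A s r) (fun u v => B u v) =
      s ^ 2 • metricTrace b (fun u v => B (horProj b A u) (horProj b A v)) +
      r ^ 2 • metricTrace b (fun u v => B (verProj b A u) (verProj b A v)) := by
  have h1 := metricTrace_comp_left b hb hsymm (B.compl₂ (horProj b A : V →ₗ[ℝ] V))
    (horProj b A) (horProj b A) (apply_horProj_left b hb hsymm A hA)
  have h2 := metricTrace_comp_left b hb hsymm (B.compl₂ (verProj b A : V →ₗ[ℝ] V))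
    (verProj b A) (verProj b A) (fun u v => by
      simp only [verProj, sub_apply, ContinuousLinearMap.id_apply, map_sub,
        apply_horProj_left b hb hsymm A hA u v])
  simp only [LinearMap.compl₂_apply, ContinuousLinearMap.coe_coe] at h1 h2
  rw [h1, h2, ← metricTrace_smul, ← metricTrace_smul, ← metricTrace_add]
  unfold metricTrace
  refine Finset.sum_congr rfl fun i _ => ?_
  rw [inverse_biconformalForm b hb hsymm A hA hs hr]
  simp [verProj, horProj_horProj b hb A hA]

include hb hsymm hA in
theorem metricTrace_eq_horProj_add_verProj {X : Type*} [AddCommGroup X] [Module ℝ X]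
    [TopologicalSpace X]
    [IsTopologicalAddGroup X] [ContinuousSMul ℝ X] [FiniteDimensional ℝ X] [T2Space X]
    (B : V →ₗ[ℝ] V →ₗ[ℝ] X) :
    metricTrace b (fun u v => B u v) =
      metricTrace b (fun u v => B (horProj b A u) (horProj b A v)) +
      metricTrace b (fun u v => B (verProj b A u) (verProj b A v)) := by
  -- With both factors equal to 1 the biconformal form is `b` itself.
  have h := metricTrace_biconformalForm b hb hsymm A hA one_pos one_pos B
  have e : biconformalForm b A 1 1 = b := by
    ext u v
    rw [biconformalForm_apply, apply_horProj_horProj b hb A hA, map_sub, map_sub b, sub_apply,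
      sub_apply, apply_horProj_horProj b hb A hA, apply_horProj_left b hb hsymm A hA u v]
    simp
  rw [e] at h
  simpa using h

end Trace

/-! ### Algebra at a point: how the traces of the second fundamental forms change. -/

section BiconformalTrace

variable {V W : Type*} [AddCommGroup V] [Module ℝ V] [TopologicalSpace V]
  [IsTopologicalAddGroup V] [ContinuousSMul ℝ V]
  [AddCommGroup W] [Module ℝ W] [TopologicalSpace W]
  [IsTopologicalAddGroup W] [ContinuousSMul ℝ W]
  [FiniteDimensional ℝ V] [T2Space V] [FiniteDimensional ℝ W] [T2Space W]

variable (b : V →L[ℝ] V →L[ℝ] ℝ) (hb : ∀ v, v ≠ 0 → 0 < b v v)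
  (hsymm : ∀ u v, b u v = b v u) (A : V →L[ℝ] W) (hA : Function.Surjective A)

include hb hsymm hA in
-- This is the test by which identities in the target are verified: two vectors have the same image
-- under `A` as soon as they pair equally with all horizontal vectors.
theorem map_eq_zero_of_apply_horProj_eq_zero {x : V} (h : ∀ z, b x (horProj b A z) = 0) :
    A x = 0 := by
  have : horProj b A x = 0 := eq_of_forall_apply_eq b hb fun z => by
    rw [apply_horProj_left b hb hsymm A hA, h]; simp
  rw [← map_horProj b hb A hA, this, map_zero]

include hb hsymm hA in
theorem inverse_comp_horProj (l : V →L[ℝ] ℝ) :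
    b.inverse (l ∘L horProj b A) = horProj b A (b.inverse l) := by
  refine eq_of_forall_apply_eq b hb fun z => ?_
  rw [apply_inverse_apply b hb, apply_horProj_left b hb hsymm A hA, apply_inverse_apply b hb]
  rfl

include hb hsymm hA in
theorem apply_verProj_verProj (u v : V) :
    b (verProj b A u) (verProj b A v) = b (verProj b A u) v := by
  have h : b (verProj b A u) (horProj b A v) = 0 := by
    rw [hsymm]; exact horProj_orthogonal b hb A _ _ (map_sub_horProj b hb A hA u)
  change b (verProj b A u) (v - horProj b A v) = _
  rw [map_sub, h, sub_zero]

include hA in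
theorem finrank_ker_eq : (finrank ℝ (LinearMap.ker A.toLinearMap) : ℝ) =
    finrank ℝ V - finrank ℝ W := by
  have h := A.toLinearMap.finrank_range_add_finrank_ker
  rw [LinearMap.range_eq_top.2 hA, finrank_top] at h
  rw [← h]; push_cast; ring

include hb hsymm hA in
theorem metricTrace_verProj_form :
    metricTrace b (fun u v => b (verProj b A u) (verProj b A v)) =
      finrank ℝ V - finrank ℝ W := by
  simp_rw [apply_verProj_verProj b hb hsymm A hA]
  rw [metricTrace_form b hb hsymm, ← trace_horProj b hb A hA, ← LinearMap.trace_id, ← map_sub]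
  rfl

include hb hsymm hA in
theorem metricTrace_horProj_form :
    metricTrace b (fun u v => b (horProj b A u) (horProj b A v)) = finrank ℝ W := by
  simp_rw [apply_horProj_horProj b hb A hA]
  rw [metricTrace_form b hb hsymm, ← trace_horProj b hb A hA]

-- `β` and `β'` stand for the second fundamental form `∇dφ` before and after the change, `s`, `r`
-- for `σ`, `ρ`, and `l`, `k` for the differentials of `ln σ`, `ln ρ`.
variable (β β' : V →ₗ[ℝ] V →ₗ[ℝ] W) {s r : ℝ} (hs : 0 < s) (hr : 0 < r) (l k : V →L[ℝ] ℝ)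
  (hhor : ∀ u v, β' (horProj b A u) (horProj b A v) = β (horProj b A u) (horProj b A v) +
    (l (horProj b A u) • A v + l (horProj b A v) • A u -
      b (horProj b A u) (horProj b A v) • A (b.inverse l)))
  (hver : ∀ u v, r ^ 2 • β' (verProj b A u) (verProj b A v) =
    s ^ 2 • (β (verProj b A u) (verProj b A v) -
      b (verProj b A u) (verProj b A v) • A (b.inverse k)))

include hb hsymm hA hhor in
-- Each of the two terms with `l` traces to `A` of the gradient of `l`, while the form `b` on
-- horizontal vectors has trace `dim W`; hence the coefficient `2 - dim W`.
theorem metricTrace_horProj_change :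
    metricTrace b (fun u v => β' (horProj b A u) (horProj b A v)) =
      metricTrace b (fun u v => β (horProj b A u) (horProj b A v)) +
        (2 - finrank ℝ W : ℝ) • A (b.inverse l) := by
  have h1 : metricTrace b (fun u v => l (horProj b A u) • A v) = A (b.inverse l) := by
    have := metricTrace_map b A.toLinearMap (fun u v => (l ∘L horProj b A) u • v)
    simp only [map_smul, ContinuousLinearMap.coe_coe] at this
    refine this.trans ?_
    rw [metricTrace_smul_right b hb, inverse_comp_horProj b hb hsymm A hA, map_horProj b hb A hA]
  have h2 : metricTrace b (fun u v => l (horProj b A v) • A u) = A (b.inverse l) := by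
    have := metricTrace_map b A.toLinearMap (fun u v => (l ∘L horProj b A) v • u)
    simp only [map_smul, ContinuousLinearMap.coe_coe] at this
    refine this.trans ?_
    rw [metricTrace_smul_left b hb hsymm, inverse_comp_horProj b hb hsymm A hA,
      map_horProj b hb A hA]
  simp_rw [hhor]
  rw [metricTrace_add, metricTrace_sub, metricTrace_add, h1, h2, metricTrace_smul_const,
    metricTrace_horProj_form b hb hsymm A hA, sub_smul, two_smul]

include hb hsymm hA hver in
theorem metricTrace_verProj_change :
    r ^ 2 • metricTrace b (fun u v => β' (verProj b A u) (verProj b A v)) =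
      s ^ 2 • (metricTrace b (fun u v => β (verProj b A u) (verProj b A v)) -
        (finrank ℝ V - finrank ℝ W : ℝ) • A (b.inverse k)) := by
  rw [← metricTrace_smul]
  simp_rw [hver]
  rw [metricTrace_smul, metricTrace_sub, metricTrace_smul_const,
    metricTrace_verProj_form b hb hsymm A hA]

include hb hsymm hA hs hr hhor hver in
theorem metricTrace_biconformal_change :
    metricTrace (biconformalForm b A s r) (fun u v => β' u v) =
      s ^ 2 • (metricTrace b (fun u v => β u v) + A (b.inverse
        ((finrank ℝ W - finrank ℝ V : ℝ) • k + (2 - finrank ℝ W : ℝ) • l))) := by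
  rw [metricTrace_biconformalForm b hb hsymm A hA hs hr,
    metricTrace_verProj_change b hb hsymm A hA β β' k hver,
    metricTrace_horProj_change b hb hsymm A hA β β' l hhor,
    metricTrace_eq_horProj_add_verProj b hb hsymm A hA β, ← smul_add]
  congr 1
  simp only [map_add, map_sub, map_smul, sub_smul]
  abel

include hb hsymm hA hs hr hver in
-- `S` and `S'` stand for the second fundamental forms of the fibres. They are not assumed bilinear:
-- only their images under `A` are, and since the values are horizontal these images determine the
-- traces.
theorem metricTrace_fibre_change (S S' : V → V → V)
    (hS : ∀ u v, A (S u v) = -β (verProj b A u) (verProj b A v))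
    (hS' : ∀ u v, A (S' u v) = -β' (verProj b A u) (verProj b A v))
    (hP : ∀ u v, horProj b A (S u v) = S u v) (hP' : ∀ u v, horProj b A (S' u v) = S' u v) :
    metricTrace (biconformalForm b A s r) S' =
      s ^ 2 • (metricTrace b S +
        (finrank ℝ V - finrank ℝ W : ℝ) • horProj b A (b.inverse k)) := by
  have e1 : horProj b A (metricTrace b S) = metricTrace b S := by
    have := metricTrace_map b (horProj b A).toLinearMap S
    simp only [ContinuousLinearMap.coe_coe, hP] at this
    exact this.symm
  have e2 : horProj b A (metricTrace (biconformalForm b A s r) S') =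
      metricTrace (biconformalForm b A s r) S' := by
    have := metricTrace_map (biconformalForm b A s r) (horProj b A).toLinearMap S'
    simp only [ContinuousLinearMap.coe_coe, hP'] at this
    exact this.symm
  have a1 : A (metricTrace b S) =
      -metricTrace b (fun u v => β (verProj b A u) (verProj b A v)) := by
    rw [← ContinuousLinearMap.coe_coe A, ← metricTrace_map]
    simp only [ContinuousLinearMap.coe_coe, hS]
    rw [← neg_one_smul ℝ (metricTrace b _), ← metricTrace_smul]
    simp
  have vv : ∀ u, verProj b A (verProj b A u) = verProj b A u := fun u => by
    simp [verProj, horProj_horProj b hb A hA]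
  have vh : ∀ u, verProj b A (horProj b A u) = 0 := fun u => by
    simp [verProj, horProj_horProj b hb A hA]
  -- Only vertical components enter, so the trace for the changed form is `r ^ 2` times the one for
  -- `b`.
  have a2 : A (metricTrace (biconformalForm b A s r) S') =
      -(r ^ 2 • metricTrace b (fun u v => β' (verProj b A u) (verProj b A v))) := by
    rw [← ContinuousLinearMap.coe_coe A, ← metricTrace_map]
    simp only [ContinuousLinearMap.coe_coe, hS']
    have := metricTrace_biconformalForm b hb hsymm A hA hs hr
      (-(β'.compl₁₂ (verProj b A : V →ₗ[ℝ] V) (verProj b A : V →ₗ[ℝ] V)))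
    simp only [LinearMap.neg_apply, LinearMap.compl₁₂_apply, ContinuousLinearMap.coe_coe, vv,
      vh, map_zero, neg_zero] at this
    rw [this, ← smul_neg, ← neg_one_smul ℝ (metricTrace b fun u v => (β' _) _),
      ← metricTrace_smul]
    simp [metricTrace]
  -- Both sides are written as horizontal projections; such a projection depends on its argument
  -- only through its image under `A`.
  rw [← e1, ← e2, ← map_smul, ← map_add, ← map_smul]
  have : A (metricTrace (biconformalForm b A s r) S') = A (s ^ 2 •
      (metricTrace b S + (finrank ℝ V - finrank ℝ W : ℝ) • (b.inverse k))) := by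
    rw [a2, metricTrace_verProj_change b hb hsymm A hA β β' k hver, map_smul, map_add, map_smul,
      a1, ← smul_neg]
    congr 1
    abel
  simp only [horProj, ContinuousLinearMap.comp_apply, this]

end BiconformalTrace

/-! ### The Koszul form and Christoffel symbols in a vector space. -/

section Koszul

variable {E : Type*} [NormedAddCommGroup E] [NormedSpace ℝ E]

/-- The Koszul form `1/2 (∂_u G(v, ·) + ∂_v G(u, ·) - ∂ G(u, v))` of the first derivative `dG` of a
metric. -/
def koszul (dG : E →L[ℝ] E →L[ℝ] E →L[ℝ] ℝ) (u v : E) : E →L[ℝ] ℝ :=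
  (1 / 2 : ℝ) • (dG u v + dG v u - (dG.flip u).flip v)

theorem koszul_apply (dG : E →L[ℝ] E →L[ℝ] E →L[ℝ] ℝ) (u v z : E) :
    koszul dG u v z = 1 / 2 * (dG u v z + dG v u z - dG z u v) := rfl

theorem koszul_add_left (dG : E →L[ℝ] E →L[ℝ] E →L[ℝ] ℝ) (u u' v : E) :
    koszul dG (u + u') v = koszul dG u v + koszul dG u' v := by
  ext z
  have h1 : dG (u + u') v z = dG u v z + dG u' v z := by rw [dG.map_add]; rfl
  have h2 : dG v (u + u') z = dG v u z + dG v u' z := by rw [(dG v).map_add]; rfl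
  have h3 : dG z (u + u') v = dG z u v + dG z u' v := by rw [(dG z).map_add]; rfl
  change koszul dG (u + u') v z = koszul dG u v z + koszul dG u' v z
  rw [koszul_apply, koszul_apply, koszul_apply, h1, h2, h3]
  ring

theorem koszul_smul_left (dG : E →L[ℝ] E →L[ℝ] E →L[ℝ] ℝ) (c : ℝ) (u v : E) :
    koszul dG (c • u) v = c • koszul dG u v := by
  ext z
  have h1 : dG (c • u) v z = c * dG u v z := by rw [dG.map_smul]; rfl
  have h2 : dG v (c • u) z = c * dG v u z := by rw [(dG v).map_smul]; rfl
  have h3 : dG z (c • u) v = c * dG z u v := by rw [(dG z).map_smul]; rfl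
  change koszul dG (c • u) v z = c * koszul dG u v z
  rw [koszul_apply, koszul_apply, h1, h2, h3]
  ring

theorem koszul_add_right (dG : E →L[ℝ] E →L[ℝ] E →L[ℝ] ℝ) (u v v' : E) :
    koszul dG u (v + v') = koszul dG u v + koszul dG u v' := by
  ext z
  have h1 : dG (v + v') u z = dG v u z + dG v' u z := by rw [dG.map_add]; rfl
  have h2 : dG u (v + v') z = dG u v z + dG u v' z := by rw [(dG u).map_add]; rfl
  have h3 : dG z u (v + v') = dG z u v + dG z u v' := (dG z u).map_add _ _
  change koszul dG u (v + v') z = koszul dG u v z + koszul dG u v' z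
  rw [koszul_apply, koszul_apply, koszul_apply, h1, h2, h3]
  ring

theorem koszul_smul_right (dG : E →L[ℝ] E →L[ℝ] E →L[ℝ] ℝ) (c : ℝ) (u v : E) :
    koszul dG u (c • v) = c • koszul dG u v := by
  ext z
  have h1 : dG (c • v) u z = c * dG v u z := by rw [dG.map_smul]; rfl
  have h2 : dG u (c • v) z = c * dG u v z := by rw [(dG u).map_smul]; rfl
  have h3 : dG z u (c • v) = c * dG z u v := (dG z u).map_smul _ _
  change koszul dG u (c • v) z = c * koszul dG u v z
  rw [koszul_apply, koszul_apply, h1, h2, h3]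
  ring

/-- The Christoffel symbols of the metric `G` with first derivative `dG`, as a bilinear map. -/
def christoffelSymbol (G : E →L[ℝ] E →L[ℝ] ℝ) (dG : E →L[ℝ] E →L[ℝ] E →L[ℝ] ℝ) :
    E →ₗ[ℝ] E →ₗ[ℝ] E :=
  LinearMap.mk₂ ℝ (fun u v => G.inverse (koszul dG u v))
    (fun u u' v => by rw [koszul_add_left, G.inverse.map_add])
    (fun c u v => by rw [koszul_smul_left, G.inverse.map_smul])
    (fun u v v' => by rw [koszul_add_right, G.inverse.map_add])
    (fun c u v => by rw [koszul_smul_right, G.inverse.map_smul])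

theorem christoffelSymbol_apply (G : E →L[ℝ] E →L[ℝ] ℝ) (dG : E →L[ℝ] E →L[ℝ] E →L[ℝ] ℝ)
    (u v : E) : christoffelSymbol G dG u v = G.inverse (koszul dG u v) := rfl

theorem hasFDerivAt_apply_apply {F F' F'' : Type*} [NormedAddCommGroup F] [NormedSpace ℝ F]
    [NormedAddCommGroup F'] [NormedSpace ℝ F'] [NormedAddCommGroup F''] [NormedSpace ℝ F'']
    {k : E → F →L[ℝ] F' →L[ℝ] F''} {dk : E →L[ℝ] F →L[ℝ] F' →L[ℝ] F''} {f : E → F} {df : E →L[ℝ] F}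
    {f' : E → F'} {df' : E →L[ℝ] F'} {y : E} (hk : HasFDerivAt k dk y) (hf : HasFDerivAt f df y)
    (hf' : HasFDerivAt f' df' y) (w : E) :
    HasLineDerivAt ℝ (fun y => k y (f y) (f' y))
      (dk w (f y) (f' y) + k y (df w) (f' y) + k y (f y) (df' w)) y w := by
  refine ((((hk.clm_apply hf).clm_apply hf').hasLineDerivAt) w).congr_deriv ?_
  simp [ContinuousLinearMap.flip_apply]
  abel

end Koszul

/-! ### First derivatives of the horizontal and vertical parts of a metric. -/

section Calculus

variable {E E' : Type*} [NormedAddCommGroup E] [NormedSpace ℝ E] [FiniteDimensional ℝ E]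
  [NormedAddCommGroup E'] [NormedSpace ℝ E'] [FiniteDimensional ℝ E']

variable (G : E → E →L[ℝ] E →L[ℝ] ℝ) (A : E → E →L[ℝ] E') (s r : E → ℝ) (x : E)

/-- First order data for a biconformal change of metric in charts: `G` is a metric, `A` the
derivative of a submersion, `s` and `r` are the conformal factors, everything near `x`. -/
structure IsBiconformalData : Prop where
  pos : ∀ᶠ y in 𝓝 x, ∀ v, v ≠ 0 → 0 < G y v v
  symm : ∀ᶠ y in 𝓝 x, ∀ u v, G y u v = G y v u
  surj : ∀ᶠ y in 𝓝 x, Function.Surjective (A y)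
  diffG : DifferentiableAt ℝ G x
  diffA : DifferentiableAt ℝ A x
  symmA : ∀ u v, fderiv ℝ A x u v = fderiv ℝ A x v u
  diffs : DifferentiableAt ℝ s x
  diffr : DifferentiableAt ℝ r x
  s_pos : 0 < s x
  r_pos : 0 < r x

variable {G A s r x}

namespace IsBiconformalData

variable (h : IsBiconformalData G A s r x)
include h

theorem differentiableAt_adj : DifferentiableAt ℝ (fun y => adj (G y) (A y)) x := by
  have : CompleteSpace E := FiniteDimensional.complete ℝ E
  have hpre' : ContDiff ℝ ∞
      (fun P : E →L[ℝ] E' => (ContinuousLinearMap.precomp ℝ P : (E' →L[ℝ] ℝ) →L[ℝ] (E →L[ℝ] ℝ))) :=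
    contDiff_clm_apply_iff.2 fun l => (contDiff_const (c := l)).clm_comp contDiff_id
  unfold adj
  refine DifferentiableAt.clm_comp ?_ ?_
  · exact DifferentiableAt.comp x (((isInvertible_of_pos _
      h.pos.self_of_nhds).contDiffAt_map_inverse (n := ∞)).differentiableAt (by simp)) h.diffG
  · exact DifferentiableAt.comp x (hpre'.differentiable (by simp) _) h.diffA

theorem differentiableAt_inverse :
    DifferentiableAt ℝ (fun y => (A y ∘L adj (G y) (A y)).inverse) x := by
  have : CompleteSpace E' := FiniteDimensional.complete ℝ E'
  exact DifferentiableAt.comp x (((isInvertible_comp_adj _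
      h.pos.self_of_nhds _ h.surj.self_of_nhds).contDiffAt_map_inverse (n := ∞)).differentiableAt
      (by simp)) (h.diffA.clm_comp h.differentiableAt_adj)

theorem differentiableAt_horProj : DifferentiableAt ℝ (fun y => horProj (G y) (A y)) x :=
  h.differentiableAt_adj.clm_comp (h.differentiableAt_inverse.clm_comp h.diffA)

/-- The horizontal part `G^H` is the pull-back under `A` of the form `(A ∘ A^*)⁻¹`. -/
theorem inverse_comp_adj_apply {y : E} (hpos : ∀ v, v ≠ 0 → 0 < G y v v) (u v : E) :
    (A y ∘L adj (G y) (A y)).inverse (A y u) (A y v) = G y (horProj (G y) (A y) u) v :=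
  (apply_adj (G y) hpos (A y) _ v).symm

/-- The derivative of the horizontal part of the metric. -/
theorem exists_horizontal_deriv : ∃ (k : E' →L[ℝ] E' →L[ℝ] ℝ) (dk : E →L[ℝ] E' →L[ℝ] E' →L[ℝ] ℝ),
    (∀ u v, k (A x u) (A x v) = G x (horProj (G x) (A x) u) v) ∧
    ∀ u v w, HasLineDerivAt ℝ (fun y => G y (horProj (G y) (A y) u) v)
      (dk w (A x u) (A x v) + k (fderiv ℝ A x w u) (A x v) + k (A x u) (fderiv ℝ A x w v)) x w := by
  -- The form `k` is `(A ∘ A^*)⁻¹` at `x`. Writing the horizontal metric as `k(A u, A v)` makes its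
  -- derivative a product rule, with no derivative of the projection.
  refine ⟨_, fderiv ℝ (fun y => (A y ∘L adj (G y) (A y)).inverse) x, fun u v => h.inverse_comp_adj_apply h.pos.self_of_nhds u v, fun u v w => ?_⟩
  have hA : ∀ u, HasFDerivAt (fun y => A y u) ((fderiv ℝ A x).flip u) x := fun u => by
    refine (h.diffA.hasFDerivAt.clm_apply (hasFDerivAt_const u x)).congr_fderiv ?_
    simp
  refine (hasFDerivAt_apply_apply h.differentiableAt_inverse.hasFDerivAt (hA u) (hA v) w
    ).congr_of_eventuallyEq ?_
  filter_upwards [h.pos] with y hy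
  exact (h.inverse_comp_adj_apply hy u v).symm

/-- The derivative of the vertical part of the metric vanishes on horizontal vectors. -/
theorem vertical_deriv (w : E) {u v : E} (hu : horProj (G x) (A x) u = u)
    (hv : horProj (G x) (A x) v = v) :
    HasLineDerivAt ℝ (fun y => G y u v - G y (horProj (G y) (A y) u) v) 0 x w := by
  have hP : ∀ u, HasFDerivAt (fun y => u - horProj (G y) (A y) u) _ x := fun u =>
    (hasFDerivAt_const u x).sub
      (h.differentiableAt_horProj.hasFDerivAt.clm_apply (hasFDerivAt_const u x))
  -- The vertical part is `G(V u, V v)`, where both arguments vanish at `x`, so every term of the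
  -- product rule is zero.
  have := hasFDerivAt_apply_apply h.diffG.hasFDerivAt (hP u) (hP v) w
  simp only [hu, hv, sub_self, map_zero, zero_apply, add_zero] at this
  refine this.congr_of_eventuallyEq ?_
  filter_upwards [h.pos, h.symm, h.surj] with y h1 h2 h3
  simp only [map_sub, sub_apply, apply_horProj_horProj _ h1 _ h3,
    apply_horProj_left _ h1 h2 _ h3 u v]
  ring

theorem lineDeriv_inv_sq {f : E → ℝ} (hf : DifferentiableAt ℝ f x) (h0 : 0 < f x) (w : E) :
    HasLineDerivAt ℝ (fun y => (f y ^ 2)⁻¹)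
      (-2 * (f x ^ 2)⁻¹ * fderiv ℝ (fun y => Real.log (f y)) x w) x w := by
  rw [fderiv.log hf h0.ne']
  refine (((hasDerivAt_inv (pow_pos h0 2).ne').comp_hasFDerivAt x
    (hf.hasFDerivAt.pow 2)).hasLineDerivAt w
    ).congr_deriv ?_
  simp
  field_simp

end IsBiconformalData

end Calculus

/-! ### Christoffel symbols of a biconformally changed metric. -/

section Change

variable {E E' : Type*} [NormedAddCommGroup E] [NormedSpace ℝ E] [FiniteDimensional ℝ E]
  [NormedAddCommGroup E'] [NormedSpace ℝ E'] [FiniteDimensional ℝ E']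
  {G : E → E →L[ℝ] E →L[ℝ] ℝ} {A : E → E →L[ℝ] E'} {s r : E → ℝ} {x : E}
  {G' : E → E →L[ℝ] E →L[ℝ] ℝ}

theorem hasLineDerivAt_fderiv_apply (hG : DifferentiableAt ℝ G x) (u v w : E) :
    HasLineDerivAt ℝ (fun y => G y u v) (fderiv ℝ G x w u v) x w := by
  refine (hasFDerivAt_apply_apply hG.hasFDerivAt (hasFDerivAt_const u x)
    (hasFDerivAt_const v x) w).congr_deriv ?_
  rw [zero_apply, (G x u).map_zero, (G x).map_zero, zero_apply, add_zero, add_zero]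

/-- In this form the projection occurs once, so differentiating the changed metric needs only the
derivative of `b(H u, v)` besides those of `b` and the factors. -/
theorem biconformalForm_eq {V W : Type*} [AddCommGroup V] [Module ℝ V] [TopologicalSpace V]
    [IsTopologicalAddGroup V] [ContinuousSMul ℝ V] [AddCommGroup W] [Module ℝ W]
    [TopologicalSpace W] [IsTopologicalAddGroup W] [ContinuousSMul ℝ W]
    [FiniteDimensional ℝ V] [T2Space V] [FiniteDimensional ℝ W] [T2Space W]
    (b : V →L[ℝ] V →L[ℝ] ℝ) (hb : ∀ v, v ≠ 0 → 0 < b v v)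
    (hsymm : ∀ u v, b u v = b v u) (A : V →L[ℝ] W) (hA : Function.Surjective A) (s r : ℝ)
    (u v : V) : biconformalForm b A s r u v =
      (r ^ 2)⁻¹ * b u v + ((s ^ 2)⁻¹ - (r ^ 2)⁻¹) * b (horProj b A u) v := by
  rw [biconformalForm_apply, map_sub, map_sub b, sub_apply, sub_apply,
    apply_horProj_horProj b hb A hA, apply_horProj_left b hb hsymm A hA u v]
  ring

namespace IsBiconformalData

variable (h : IsBiconformalData G A s r x) (hG' : DifferentiableAt ℝ G' x)
  (hG'G : ∀ᶠ y in 𝓝 x, G' y = biconformalForm (G y) (A y) (s y) (r y))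
include h hG' hG'G

/-- The derivative `d` of the horizontal part is left as a parameter, since it is computed
differently for horizontal and for vertical arguments. -/
theorem fderiv_biconformal (u v w : E) {d : ℝ}
    (hd : HasLineDerivAt ℝ (fun y => G y (horProj (G y) (A y) u) v) d x w) :
    fderiv ℝ G' x w u v =
      (r x ^ 2)⁻¹ * (fderiv ℝ G x w u v - 2 * fderiv ℝ (fun y => Real.log (r y)) x w * G x u v) +
      ((s x ^ 2)⁻¹ - (r x ^ 2)⁻¹) * d +
      (-2 * (s x ^ 2)⁻¹ * fderiv ℝ (fun y => Real.log (s y)) x w +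
        2 * (r x ^ 2)⁻¹ * fderiv ℝ (fun y => Real.log (r y)) x w) *
          G x (horProj (G x) (A x) u) v := by
  have ha := h.lineDeriv_inv_sq h.diffs h.s_pos w
  have hb := h.lineDeriv_inv_sq h.diffr h.r_pos w
  have hG := hasLineDerivAt_fderiv_apply h.diffG u v w
  have e : (fun y => G' y u v) =ᶠ[𝓝 x] fun y => (r y ^ 2)⁻¹ * G y u v +
      ((s y ^ 2)⁻¹ - (r y ^ 2)⁻¹) * G y (horProj (G y) (A y) u) v := by
    filter_upwards [hG'G, h.pos, h.symm, h.surj] with y h0 h1 h2 h3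
    rw [h0, biconformalForm_eq _ h1 h2 _ h3]
  have h1 := (hasLineDerivAt_fderiv_apply hG' u v w).congr_of_eventuallyEq e.symm
  unfold HasLineDerivAt at ha hb hG hd h1
  have h2 := (hb.mul hG).add ((ha.sub hb).mul hd)
  have h3 := h1.unique h2
  simp only [zero_smul, add_zero] at h3
  rw [h3]
  simp only [Pi.sub_apply, zero_smul, add_zero]
  ring

theorem apply_of_horizontal (y z : E) (hz : horProj (G x) (A x) z = z) :
    G' x y z = (s x ^ 2)⁻¹ * G x y z := by
  rw [hG'G.self_of_nhds, biconformalForm_eq _ h.pos.self_of_nhds h.symm.self_of_nhds _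
    h.surj.self_of_nhds, apply_horProj_left _ h.pos.self_of_nhds h.symm.self_of_nhds _
    h.surj.self_of_nhds, hz]
  ring

theorem pos_change (v : E) (hv : v ≠ 0) : 0 < G' x v v := by
  rw [hG'G.self_of_nhds]
  exact biconformalForm_pos _ h.pos.self_of_nhds _ h.s_pos h.r_pos v hv

/-- The Christoffel symbols of a biconformally changed metric on horizontal vectors. -/
theorem christoffel_horizontal {u v : E} (hu : horProj (G x) (A x) u = u)
    (hv : horProj (G x) (A x) v = v) :
    A x (christoffelSymbol (G' x) (fderiv ℝ G' x) u v) =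
      A x (christoffelSymbol (G x) (fderiv ℝ G x) u v) -
      (fderiv ℝ (fun y => Real.log (s y)) x u • A x v +
        fderiv ℝ (fun y => Real.log (s y)) x v • A x u -
        G x u v • A x ((G x).inverse (fderiv ℝ (fun y => Real.log (s y)) x))) := by
  have hpos := h.pos.self_of_nhds
  have hsymm := h.symm.self_of_nhds
  have hsurj := h.surj.self_of_nhds
  set l := fderiv ℝ (fun y => Real.log (s y)) x with hl
  obtain ⟨k, dk, hk, hdk⟩ := h.exists_horizontal_deriv
  -- For vectors horizontal at `x` the vertical part has zero derivative, so the horizontal part has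
  -- the same derivative as `G`: the formula of a purely conformal change by `s⁻²`.
  have hd : ∀ u v w, horProj (G x) (A x) u = u → horProj (G x) (A x) v = v →
      fderiv ℝ G' x w u v = (s x ^ 2)⁻¹ * (fderiv ℝ G x w u v - 2 * l w * G x u v) := by
    intro u v w hu hv
    have h1 := h.vertical_deriv w hu hv
    have h2 := hasLineDerivAt_fderiv_apply h.diffG u v w
    have h3 : HasLineDerivAt ℝ (fun y => G y (horProj (G y) (A y) u) v)
        (fderiv ℝ G x w u v) x w := by
      have := HasDerivAt.sub h2 h1
      simpa [HasLineDerivAt, Pi.sub_def] using this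
    rw [h.fderiv_biconformal hG' hG'G u v w h3, hu]
    ring
  rw [← sub_eq_zero]
  have key : A x (christoffelSymbol (G' x) (fderiv ℝ G' x) u v -
      christoffelSymbol (G x) (fderiv ℝ G x) u v + (l u • v + l v • u -
        G x u v • (G x).inverse l)) = 0 := by
    refine map_eq_zero_of_apply_horProj_eq_zero (G x) hpos hsymm _ hsurj fun z' => ?_
    have hz := horProj_horProj (G x) hpos (A x) hsurj z'
    set z := horProj (G x) (A x) z'
    have e1 := h.apply_of_horizontal hG' hG'G
      (christoffelSymbol (G' x) (fderiv ℝ G' x) u v) z hz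
    rw [christoffelSymbol_apply, apply_inverse_apply _ (h.pos_change hG' hG'G), koszul_apply,
      hd v z u hv hz, hd u z v hu hz, hd u v z hu hv] at e1
    have e2 := apply_inverse_apply (G x) hpos (koszul (fderiv ℝ G x) u v) z
    rw [koszul_apply] at e2
    have hs0 : s x ≠ 0 := h.s_pos.ne'
    have hs : s x ^ 2 ≠ 0 := pow_ne_zero 2 hs0
    rw [christoffelSymbol_apply, christoffelSymbol_apply]
    simp only [(G x).map_add, (G x).map_sub, (G x).map_smul, add_apply, sub_apply, smul_apply,
      smul_eq_mul, e2, apply_inverse_apply (G x) hpos l]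
    have e3 : G x ((G' x).inverse (koszul (fderiv ℝ G' x) u v)) z = s x ^ 2 *
        (1 / 2 * ((s x ^ 2)⁻¹ * (fderiv ℝ G x u v z - 2 * l u * G x v z) +
          (s x ^ 2)⁻¹ * (fderiv ℝ G x v u z - 2 * l v * G x u z) -
          (s x ^ 2)⁻¹ * (fderiv ℝ G x z u v - 2 * l z * G x u v))) := by
      rw [e1, mul_inv_cancel_left₀ hs]
    rw [e3]
    field_simp
    ring
  rw [← key]
  simp only [map_add, map_sub, map_smul]
  abel

/-- The Christoffel symbols of a biconformally changed metric on vertical vectors. -/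
theorem christoffel_vertical {u v : E} (hu : A x u = 0) (hv : A x v = 0) :
    r x ^ 2 • (fderiv ℝ A x u v - A x (christoffelSymbol (G' x) (fderiv ℝ G' x) u v)) =
      s x ^ 2 • (fderiv ℝ A x u v - A x (christoffelSymbol (G x) (fderiv ℝ G x) u v) -
        G x u v • A x ((G x).inverse (fderiv ℝ (fun y => Real.log (r y)) x))) := by
  have hpos := h.pos.self_of_nhds
  have hsymm := h.symm.self_of_nhds
  have hsurj := h.surj.self_of_nhds
  set l := fderiv ℝ (fun y => Real.log (r y)) x with hl
  obtain ⟨k, dk, hk, hdk⟩ := h.exists_horizontal_deriv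
  -- The second derivative is lifted to a vector `y` of the source, so that it too can be tested
  -- against horizontal vectors.
  obtain ⟨y, hy⟩ := hsurj (fderiv ℝ A x u v)
  have hP : ∀ w, A x w = 0 → horProj (G x) (A x) w = 0 := fun w hw => by
    simp [horProj, hw]
  have hs0 : s x ≠ 0 := h.s_pos.ne'
  have hr0 : r x ≠ 0 := h.r_pos.ne'
  have hs : s x ^ 2 ≠ 0 := pow_ne_zero 2 hs0
  have key : A x (r x ^ 2 • (y - christoffelSymbol (G' x) (fderiv ℝ G' x) u v) -
      s x ^ 2 • (y - christoffelSymbol (G x) (fderiv ℝ G x) u v - G x u v • (G x).inverse l)) =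
      0 := by
    refine map_eq_zero_of_apply_horProj_eq_zero (G x) hpos hsymm _ hsurj fun z' => ?_
    have hz := horProj_horProj (G x) hpos (A x) hsurj z'
    set z := horProj (G x) (A x) z'
    -- For vertical `u` and horizontal `z` the two terms of the product rule that contain `A u`
    -- vanish, and so do the derivatives of the conformal factors, being multiplied by `G(u, z) =
    -- 0`.
    have hd : ∀ u w, A x u = 0 → G x u z = 0 →
        fderiv ℝ G' x w u z = (r x ^ 2)⁻¹ * fderiv ℝ G x w u z +
        ((s x ^ 2)⁻¹ - (r x ^ 2)⁻¹) * k (fderiv ℝ A x w u) (A x z) := by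
      intro u w hu huz
      rw [h.fderiv_biconformal hG' hG'G u z w (hdk u z w), hP u hu, hu, huz]
      simp only [(dk w).map_zero, k.map_zero, (G x).map_zero, zero_apply]
      ring
    have hort : ∀ w, A x w = 0 → G x w z = 0 := fun w hw => by
      rw [hsymm, ← hz]; exact horProj_orthogonal (G x) hpos (A x) _ _ hw
    -- With both arguments vertical the derivative of the horizontal part vanishes altogether; this
    -- is the only term that differentiates `r`.
    have hd1 : fderiv ℝ G' x z u v = (r x ^ 2)⁻¹ * (fderiv ℝ G x z u v - 2 * l z * G x u v) := by
      rw [h.fderiv_biconformal hG' hG'G u v z (hdk u v z), hP u hu, hu, hv]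
      simp only [(dk z).map_zero, k.map_zero, (G x).map_zero, zero_apply, map_zero]
      ring
    have hky : k (fderiv ℝ A x u v) (A x z) = G x y z := by
      rw [← hy, hk, apply_horProj_left (G x) hpos hsymm _ hsurj, hz]
    have e1 := h.apply_of_horizontal hG' hG'G
      (christoffelSymbol (G' x) (fderiv ℝ G' x) u v) z hz
    -- Symmetry of `∂A` makes the contributions of the first two Koszul terms equal: both are `G(y,
    -- z)`.
    rw [christoffelSymbol_apply, apply_inverse_apply _ (h.pos_change hG' hG'G), koszul_apply,
      hd v u hv (hort v hv), hd u v hu (hort u hu), hd1,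
      h.symmA v u, hky] at e1
    have e2 := apply_inverse_apply (G x) hpos (koszul (fderiv ℝ G x) u v) z
    rw [koszul_apply] at e2
    rw [christoffelSymbol_apply, christoffelSymbol_apply]
    simp only [(G x).map_sub, (G x).map_smul, sub_apply, smul_apply,
      smul_eq_mul, e2, apply_inverse_apply (G x) hpos l]
    have e3 : G x ((G' x).inverse (koszul (fderiv ℝ G' x) u v)) z = s x ^ 2 *
        (1 / 2 * ((r x ^ 2)⁻¹ * fderiv ℝ G x u v z + ((s x ^ 2)⁻¹ - (r x ^ 2)⁻¹) * G x y z +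
          ((r x ^ 2)⁻¹ * fderiv ℝ G x v u z + ((s x ^ 2)⁻¹ - (r x ^ 2)⁻¹) * G x y z) -
          (r x ^ 2)⁻¹ * (fderiv ℝ G x z u v - 2 * l z * G x u v))) := by
      rw [e1, mul_inv_cancel_left₀ hs]
    rw [e3]
    field_simp
    ring
  rw [← sub_eq_zero, ← key]
  simp only [map_sub, map_smul, hy]

end IsBiconformalData

end Change

/-! ### Naturality of the horizontal projection. -/

section Naturality

variable {V W V' W' : Type*} [AddCommGroup V] [Module ℝ V] [TopologicalSpace V]
  [IsTopologicalAddGroup V] [ContinuousSMul ℝ V] [FiniteDimensional ℝ V] [T2Space V]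
  [AddCommGroup W] [Module ℝ W] [TopologicalSpace W]
  [IsTopologicalAddGroup W] [ContinuousSMul ℝ W] [FiniteDimensional ℝ W] [T2Space W]
  [AddCommGroup V'] [Module ℝ V'] [TopologicalSpace V']
  [IsTopologicalAddGroup V'] [ContinuousSMul ℝ V'] [FiniteDimensional ℝ V'] [T2Space V']
  [AddCommGroup W'] [Module ℝ W'] [TopologicalSpace W']
  [IsTopologicalAddGroup W'] [ContinuousSMul ℝ W'] [FiniteDimensional ℝ W'] [T2Space W']

/-- Naturality of the horizontal projection under linear isomorphisms. -/
theorem horProj_naturality (b : V →L[ℝ] V →L[ℝ] ℝ) (hb : ∀ v, v ≠ 0 → 0 < b v v)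
    (A : V →L[ℝ] W) (hA : Function.Surjective A) (T : V' ≃L[ℝ] V) (S : W ≃L[ℝ] W') (u : V') :
    T (horProj (pullbackForm b (T : V' →L[ℝ] V)) ((S : W →L[ℝ] W') ∘L A ∘L (T : V' →L[ℝ] V)) u) =
      horProj b A (T u) := by
  have hb' : ∀ v, v ≠ 0 → 0 < pullbackForm b (T : V' →L[ℝ] V) v v := fun v hv =>
    hb _ (by simpa using hv)
  have hA' : Function.Surjective ((S : W →L[ℝ] W') ∘L A ∘L (T : V' →L[ℝ] V)) :=
    S.surjective.comp (hA.comp T.surjective)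
  refine eq_horProj _ hb _ hA _ _ ?_ fun w hw => ?_
  · have := map_horProj _ hb' _ hA' u
    simpa using this
  · have := horProj_orthogonal _ hb' ((S : W →L[ℝ] W') ∘L A ∘L (T : V' →L[ℝ] V)) u (T.symm w)
      (by simpa using hw)
    simpa [pullbackForm_apply] using this

end Naturality

/-! ### Tangent vectors, metrics and derivatives in charts. -/

section Charts

variable {E : Type*} [NormedAddCommGroup E] [NormedSpace ℝ E] [FiniteDimensional ℝ E]
  {M : Type*} [TopologicalSpace M] [ChartedSpace E M]
  {E' : Type*} [NormedAddCommGroup E'] [NormedSpace ℝ E'] [FiniteDimensional ℝ E']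
  {N : Type*} [TopologicalSpace N] [ChartedSpace E' N]
  [IsManifold 𝓘(ℝ, E) ∞ M] [IsManifold 𝓘(ℝ, E') ∞ N]

/-- The tangent space at `p` is by definition the model space, identified by the preferred chart at
`p`. Hence all local expressions agree with the intrinsic objects at the base point. -/
theorem toChart_self (p : M) : toChart (E := E) p p = ContinuousLinearMap.id ℝ E := by
  unfold toChart
  rw [TangentBundle.continuousLinearMapAt_trivializationAt (mem_chart_source E p)]
  exact mfderiv_extChartAt_self

theorem ofChart_self (p : M) : ofChart (E := E) p p = ContinuousLinearMap.id ℝ E := by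
  unfold ofChart
  rw [TangentBundle.symmL_trivializationAt (mem_chart_source E p)]
  exact mfderivWithin_range_extChartAt_symm

/-- The isomorphism of the model space with `T_q M` given by the chart around `p`. -/
def chartEquiv (p q : M) (hq : q ∈ (chartAt E p).source) : E ≃L[ℝ] TangentSpace 𝓘(ℝ, E) q :=
  ((trivializationAt E (TangentSpace 𝓘(ℝ, E) : M → Type _) p).continuousLinearEquivAt ℝ q
    (by simpa using hq)).symm

theorem coe_chartEquiv (p q : M) (hq : q ∈ (chartAt E p).source) :
    (chartEquiv p q hq : E →L[ℝ] TangentSpace 𝓘(ℝ, E) q) = ofChart p q :=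
  Bundle.Trivialization.symm_continuousLinearEquivAt_eq' _ (by simpa using hq)

theorem coe_chartEquiv_symm (p q : M) (hq : q ∈ (chartAt E p).source) :
    ((chartEquiv p q hq).symm : TangentSpace 𝓘(ℝ, E) q →L[ℝ] E) = toChart p q := by
  ext v
  exact congrFun (Bundle.Trivialization.coe_continuousLinearEquivAt_eq (R := ℝ) _ (by simpa using hq)) v

/-- The local expression of the derivative of `φ` in the charts around `p` and `φ p`. -/
def chartDeriv (φ : M → N) (p : M) (y : E) : E →L[ℝ] E' :=
  toChart (φ p) (φ ((extChartAt 𝓘(ℝ, E) p).symm y)) ∘L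
    mfderiv 𝓘(ℝ, E) 𝓘(ℝ, E') φ ((extChartAt 𝓘(ℝ, E) p).symm y) ∘L
    ofChart p ((extChartAt 𝓘(ℝ, E) p).symm y)

theorem chartDeriv_self (φ : M → N) (p : M) :
    @Eq (E →L[ℝ] E') (chartDeriv (E := E) (E' := E') φ p (extChartAt 𝓘(ℝ, E) p p))
      (mfderiv 𝓘(ℝ, E) 𝓘(ℝ, E') φ p) := by
  unfold chartDeriv
  rw [extChartAt_to_inv, ofChart_self, toChart_self (E := E') (φ p)]
  rfl

theorem chartMetric_self (g : Metric E M) (p : M) :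
    chartMetric g p (extChartAt 𝓘(ℝ, E) p p) = g.inner p := by
  unfold chartMetric
  rw [extChartAt_to_inv, ofChart_self]
  rfl

theorem eventually_symm_mem_source (p : M) : ∀ᶠ y in 𝓝 (extChartAt 𝓘(ℝ, E) p p),
    (extChartAt 𝓘(ℝ, E) p).symm y ∈ (chartAt E p).source ∧
      extChartAt 𝓘(ℝ, E) p ((extChartAt 𝓘(ℝ, E) p).symm y) = y := by
  filter_upwards [extChartAt_target_mem_nhds (I := 𝓘(ℝ, E)) p] with y hy
  refine ⟨?_, (extChartAt 𝓘(ℝ, E) p).right_inv hy⟩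
  have := (extChartAt 𝓘(ℝ, E) p).map_target hy
  rwa [extChartAt_source] at this

theorem tendsto_extChartAt_symm (p : M) :
    Filter.Tendsto (extChartAt 𝓘(ℝ, E) p).symm (𝓝 (extChartAt 𝓘(ℝ, E) p p)) (𝓝 p) := by
  have := continuousAt_extChartAt_symm (I := 𝓘(ℝ, E)) p
  rwa [ContinuousAt, extChartAt_to_inv] at this

theorem contMDiffAt_extChartAt_symm (p : M) :
    ContMDiffAt 𝓘(ℝ, E) 𝓘(ℝ, E) ∞ (extChartAt 𝓘(ℝ, E) p).symm (extChartAt 𝓘(ℝ, E) p p) :=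
  (contMDiffOn_extChartAt_symm p).contMDiffAt (extChartAt_target_mem_nhds p)

theorem contDiffAt_comp_extChartAt_symm {F : Type*} [NormedAddCommGroup F] [NormedSpace ℝ F]
    {f : M → F} {p : M} (hf : ContMDiffAt 𝓘(ℝ, E) 𝓘(ℝ, F) ∞ f p) :
    ContDiffAt ℝ ∞ (fun y => f ((extChartAt 𝓘(ℝ, E) p).symm y)) (extChartAt 𝓘(ℝ, E) p p) := by
  rw [← contMDiffAt_iff_contDiffAt]
  refine ContMDiffAt.comp _ ?_ (contMDiffAt_extChartAt_symm p)
  rwa [extChartAt_to_inv]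

/-- Chain rule through the chart around `p`, whose derivative at `p` is the identity. -/
theorem mvfderiv_eq_fderiv {F : Type*} [NormedAddCommGroup F] [NormedSpace ℝ F]
    {f : M → F} {k : E → F} {p : M} (hfk : ∀ᶠ q in 𝓝 p, f q = k (extChartAt 𝓘(ℝ, E) p q))
    (hk : DifferentiableAt ℝ k (extChartAt 𝓘(ℝ, E) p p)) (u : E) :
    mvfderiv 𝓘(ℝ, E) f p u = fderiv ℝ k (extChartAt 𝓘(ℝ, E) p p) u := by
  have h1 : HasMFDerivAt 𝓘(ℝ, E) 𝓘(ℝ, E) (extChartAt 𝓘(ℝ, E) p) p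
      (ContinuousLinearMap.id ℝ E) := by
    have := (mdifferentiableAt_extChartAt (I := 𝓘(ℝ, E)) (mem_chart_source E p)).hasMFDerivAt
    rwa [mfderiv_extChartAt_self] at this
  have h2 := (hk.hasFDerivAt.hasMFDerivAt.comp p h1).congr_of_eventuallyEq hfk
  unfold mvfderiv
  rw [h2.mfderiv]
  rfl

theorem eventually_mem_source (p : M) : ∀ᶠ q in 𝓝 p, q ∈ (chartAt E p).source ∧
    (extChartAt 𝓘(ℝ, E) p).symm (extChartAt 𝓘(ℝ, E) p q) = q := by
  filter_upwards [(chartAt E p).open_source.mem_nhds (mem_chart_source E p)] with q hq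
  exact ⟨hq, (extChartAt 𝓘(ℝ, E) p).left_inv (by simpa using hq)⟩

/-- The extension that defines `hessianMap` has constant coordinates in the chart around `p`, so its
coordinate derivatives vanish. -/
theorem extend_eq_ofChart (p q : M) (hq : q ∈ (chartAt E p).source)
    (v : TangentSpace 𝓘(ℝ, E) p) : FiberBundle.extend E v q = ofChart (E := E) p q v := by
  have h : toChart (E := E) p p v = v := by rw [toChart_self]; rfl
  conv_rhs => rw [← h]
  unfold toChart
  rw [Bundle.Trivialization.continuousLinearMapAt_apply,
    Bundle.Trivialization.coe_linearMapAt_of_mem _ (FiberBundle.mem_baseSet_trivializationAt' p)]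
  exact (Bundle.Trivialization.symmL_apply _ (by simpa using hq) _).symm

theorem toChart_ofChart (p q : M) (hq : q ∈ (chartAt E p).source) (v : E) :
    toChart p q (ofChart p q v) = v := by
  rw [← coe_chartEquiv p q hq, ← coe_chartEquiv_symm p q hq]
  simp

end Charts

/-! ### Regularity of the local expressions; the biconformal change in charts. -/

section ChartMaps

variable {E : Type*} [NormedAddCommGroup E] [NormedSpace ℝ E] [FiniteDimensional ℝ E]
  {M : Type*} [TopologicalSpace M] [ChartedSpace E M]
  {E' : Type*} [NormedAddCommGroup E'] [NormedSpace ℝ E'] [FiniteDimensional ℝ E']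
  {N : Type*} [TopologicalSpace N] [ChartedSpace E' N]
  [IsManifold 𝓘(ℝ, E) ∞ M] [IsManifold 𝓘(ℝ, E') ∞ N]

theorem eventually_map_symm_mem_source {φ : M → N} (hφ : ContMDiff 𝓘(ℝ, E) 𝓘(ℝ, E') ∞ φ) (p : M) :
    ∀ᶠ y in 𝓝 (extChartAt 𝓘(ℝ, E) p p),
      φ ((extChartAt 𝓘(ℝ, E) p).symm y) ∈ (chartAt E' (φ p)).source :=
  (tendsto_extChartAt_symm p).eventually ((hφ p).continuousAt.eventually
    ((chartAt E' (φ p)).open_source.mem_nhds (mem_chart_source E' (φ p))))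

theorem contDiffAt_chartMap {φ : M → N} (hφ : ContMDiff 𝓘(ℝ, E) 𝓘(ℝ, E') ∞ φ) (p : M) :
    ContDiffAt ℝ ∞ (fun y => extChartAt 𝓘(ℝ, E') (φ p) (φ ((extChartAt 𝓘(ℝ, E) p).symm y)))
      (extChartAt 𝓘(ℝ, E) p p) :=
  contDiffAt_comp_extChartAt_symm (f := fun q => extChartAt 𝓘(ℝ, E') (φ p) (φ q))
    (contMDiffAt_extChartAt.comp p (hφ p))

/-- Being a Fréchet derivative near the point, not only at it, `chartDeriv` inherits
differentiability and the symmetry of second derivatives. -/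
theorem chartDeriv_eventuallyEq {φ : M → N} (hφ : ContMDiff 𝓘(ℝ, E) 𝓘(ℝ, E') ∞ φ) (p : M) :
    chartDeriv (E := E) (E' := E') φ p =ᶠ[𝓝 (extChartAt 𝓘(ℝ, E) p p)]
      fderiv ℝ (fun y => extChartAt 𝓘(ℝ, E') (φ p) (φ ((extChartAt 𝓘(ℝ, E) p).symm y))) := by
  filter_upwards [eventually_symm_mem_source p, eventually_map_symm_mem_source hφ p,
    extChartAt_target_mem_nhds (I := 𝓘(ℝ, E)) p] with y ⟨hy, hy'⟩ hN hyt
  have hsymm := (contMDiffOn_extChartAt_symm (I := 𝓘(ℝ, E)) (n := ∞) p).contMDiffAt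
    ((isOpen_extChartAt_target p).mem_nhds hyt)
  set q := (extChartAt 𝓘(ℝ, E) p).symm y with hq
  have d1 := (hsymm.mdifferentiableAt (by simp)).hasMFDerivAt
  have d2 := ((hφ q).mdifferentiableAt (by simp)).hasMFDerivAt
  have d3 := (mdifferentiableAt_extChartAt (I := 𝓘(ℝ, E')) hN).hasMFDerivAt
  have d := (d3.comp q d2).comp y d1
  have e1 : toChart (E := E') (φ p) (φ q) =
      mfderiv 𝓘(ℝ, E') 𝓘(ℝ, E') (extChartAt 𝓘(ℝ, E') (φ p)) (φ q) :=
    TangentBundle.continuousLinearMapAt_trivializationAt hN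
  have e2 : ofChart (E := E) p q =
      mfderiv 𝓘(ℝ, E) 𝓘(ℝ, E) (extChartAt 𝓘(ℝ, E) p).symm y := by
    refine (TangentBundle.symmL_trivializationAt hy).trans ?_
    rw [hy', modelWithCornersSelf_coe, Set.range_id, mfderivWithin_univ]
  refine Eq.symm (HasFDerivAt.fderiv (hasMFDerivAt_iff_hasFDerivAt.1 ?_))
  have e3 : chartDeriv (E := E) (E' := E') φ p y = (toChart (E := E') (φ p) (φ q)) ∘L
    (mfderiv 𝓘(ℝ, E) 𝓘(ℝ, E') φ q) ∘L (ofChart (E := E) p q) := rfl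
  rw [e3, e1, e2]
  exact d

theorem differentiableAt_chartDeriv {φ : M → N} (hφ : ContMDiff 𝓘(ℝ, E) 𝓘(ℝ, E') ∞ φ) (p : M) :
    DifferentiableAt ℝ (chartDeriv (E := E) (E' := E') φ p) (extChartAt 𝓘(ℝ, E) p p) :=
  (((contDiffAt_chartMap hφ p).fderiv_right (m := 1) (by norm_num; exact WithTop.coe_le_coe.2 (le_top : (2 : ℕ∞) ≤ ⊤))).differentiableAt
    (by simp)).congr_of_eventuallyEq (chartDeriv_eventuallyEq hφ p)

theorem fderiv_chartDeriv_symm {φ : M → N} (hφ : ContMDiff 𝓘(ℝ, E) 𝓘(ℝ, E') ∞ φ) (p : M)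
    (u v : E) :
    fderiv ℝ (chartDeriv (E := E) (E' := E') φ p) (extChartAt 𝓘(ℝ, E) p p) u v =
      fderiv ℝ (chartDeriv (E := E) (E' := E') φ p) (extChartAt 𝓘(ℝ, E) p p) v u := by
  rw [(chartDeriv_eventuallyEq hφ p).fderiv_eq]
  exact ((contDiffAt_chartMap hφ p).isSymmSndFDerivAt (by simp; exact WithTop.coe_le_coe.2 (le_top : (2 : ℕ∞) ≤ ⊤))) u v

theorem differentiableAt_chartMetric (g : Metric E M) (p : M) :
    DifferentiableAt ℝ (chartMetric g p) (extChartAt 𝓘(ℝ, E) p p) := by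
  have hg := ((contMDiffAt_hom_bundle _).1 (g.contMDiff p)).2
  have h := (contDiffAt_comp_extChartAt_symm hg).differentiableAt (by simp)
  refine h.congr_of_eventuallyEq ?_
  filter_upwards [eventually_symm_mem_source p] with y ⟨hy, hy'⟩
  set q := (extChartAt 𝓘(ℝ, E) p).symm y with hq
  have hq' : q ∈ (trivializationAt E (TangentSpace 𝓘(ℝ, E) : M → Type _) p).baseSet := by
    simpa using hy
  ext u v
  have := inCoordinates_apply_eq₂ (F₁ := E) (E₁ := (TangentSpace 𝓘(ℝ, E) : M → Type _))
    (F₂ := E) (E₂ := (TangentSpace 𝓘(ℝ, E) : M → Type _)) (F₃ := ℝ)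
    (E₃ := Bundle.Trivial M ℝ) (x₀ := p) (ϕ := g.inner q) (v := u) (w := v) hq' hq' (Set.mem_univ q)
  refine Eq.trans ?_ this.symm
  rw [← Bundle.Trivialization.symmL_apply (R := ℝ) _ hq', ← Bundle.Trivialization.symmL_apply (R := ℝ) _ hq']
  simp
  rfl

theorem chartMetric_eq (g : Metric E M) (p : M) (y : E)
    (hy : (extChartAt 𝓘(ℝ, E) p).symm y ∈ (chartAt E p).source) :
    chartMetric g p y = pullbackForm (g.inner ((extChartAt 𝓘(ℝ, E) p).symm y))
      (chartEquiv p _ hy : E →L[ℝ] TangentSpace 𝓘(ℝ, E) ((extChartAt 𝓘(ℝ, E) p).symm y)) := by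
  rw [coe_chartEquiv]; rfl

theorem chartDeriv_eq (φ : M → N) (p : M) (y : E)
    (hy : (extChartAt 𝓘(ℝ, E) p).symm y ∈ (chartAt E p).source)
    (hy' : φ ((extChartAt 𝓘(ℝ, E) p).symm y) ∈ (chartAt E' (φ p)).source) :
    chartDeriv (E := E) (E' := E') φ p y =
      ((chartEquiv (E := E') (φ p) _ hy').symm : _ →L[ℝ] E') ∘L
        mfderiv 𝓘(ℝ, E) 𝓘(ℝ, E') φ ((extChartAt 𝓘(ℝ, E) p).symm y) ∘L
        (chartEquiv p _ hy : E →L[ℝ] TangentSpace 𝓘(ℝ, E) ((extChartAt 𝓘(ℝ, E) p).symm y)) := by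
  rw [coe_chartEquiv, coe_chartEquiv_symm]; rfl

variable (g : Metric E M) (h : Metric E' N) (φ : M → N) (σ ρ : M → ℝ)
  (hφ : ContMDiff 𝓘(ℝ, E) 𝓘(ℝ, E') ∞ φ)
  (hsub : ∀ x, Function.Surjective (mfderiv 𝓘(ℝ, E) 𝓘(ℝ, E') φ x))
  (hσ : ContMDiff 𝓘(ℝ, E) 𝓘(ℝ, ℝ) ∞ σ) (hσ0 : ∀ x, 0 < σ x)
  (hρ : ContMDiff 𝓘(ℝ, E) 𝓘(ℝ, ℝ) ∞ ρ) (hρ0 : ∀ x, 0 < ρ x) (p : M)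

include hφ hsub hσ hσ0 hρ hρ0 in
theorem isBiconformalData_chart : IsBiconformalData (chartMetric g p)
    (chartDeriv (E := E) (E' := E') φ p) (fun y => σ ((extChartAt 𝓘(ℝ, E) p).symm y))
    (fun y => ρ ((extChartAt 𝓘(ℝ, E) p).symm y)) (extChartAt 𝓘(ℝ, E) p p) where
  pos := by
    filter_upwards [eventually_symm_mem_source p] with y ⟨hy, _⟩ v hv
    rw [chartMetric_eq g p y hy]
    exact g.pos _ _ ((chartEquiv p _ hy).map_eq_zero_iff.not.2 hv)
  symm := by
    filter_upwards [eventually_symm_mem_source p] with y ⟨hy, _⟩ u v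
    rw [chartMetric_eq g p y hy]
    exact g.symm _ _ _
  surj := by
    filter_upwards [eventually_symm_mem_source p, eventually_map_symm_mem_source hφ p]
      with y ⟨hy, _⟩ hy'
    rw [chartDeriv_eq φ p y hy hy']
    exact (chartEquiv (E := E') (φ p) _ hy').symm.surjective.comp
      ((hsub _).comp (chartEquiv p _ hy).surjective)
  diffG := differentiableAt_chartMetric g p
  diffA := differentiableAt_chartDeriv hφ p
  symmA := fderiv_chartDeriv_symm hφ p
  diffs := (contDiffAt_comp_extChartAt_symm (hσ p)).differentiableAt (by simp)
  diffr := (contDiffAt_comp_extChartAt_symm (hρ p)).differentiableAt (by simp)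
  s_pos := hσ0 _
  r_pos := hρ0 _

theorem chartMetric_biconformalChange : ∀ᶠ y in 𝓝 (extChartAt 𝓘(ℝ, E) p p),
    chartMetric (biconformalChange g φ σ ρ hφ hsub hσ hσ0 hρ hρ0) p y =
      biconformalForm (chartMetric g p y) (chartDeriv (E := E) (E' := E') φ p y)
        (σ ((extChartAt 𝓘(ℝ, E) p).symm y)) (ρ ((extChartAt 𝓘(ℝ, E) p).symm y)) := by
  filter_upwards [eventually_symm_mem_source p, eventually_map_symm_mem_source hφ p]
    with y ⟨hy, _⟩ hy'
  rw [chartDeriv_eq φ p y hy hy', chartMetric_eq g p y hy, chartMetric_eq _ p y hy]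
  exact (biconformalForm_naturality _ (g.pos _) _ (hsub _) _ _ _ _).symm

end ChartMaps

/-! ### The second fundamental form in charts under the change of metric. -/

section SecondForm

variable {E E' : Type*} [NormedAddCommGroup E] [NormedSpace ℝ E] [FiniteDimensional ℝ E]
  [NormedAddCommGroup E'] [NormedSpace ℝ E'] [FiniteDimensional ℝ E']

/-- The local expression `∂A(u, v) + Γ'(A u, A v) - A Γ(u, v)` of the second fundamental form of a
map with derivative `A`, where `Γ` are the Christoffel symbols of `G`. -/
def secondForm (G : E → E →L[ℝ] E →L[ℝ] ℝ) (Γ' : E' →ₗ[ℝ] E' →ₗ[ℝ] E') (A : E → E →L[ℝ] E')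
    (x : E) : E →ₗ[ℝ] E →ₗ[ℝ] E' :=
  (ContinuousLinearMap.coeLM ℝ).comp (fderiv ℝ A x).toLinearMap +
    Γ'.compl₁₂ (A x).toLinearMap (A x).toLinearMap -
    (christoffelSymbol (G x) (fderiv ℝ G x)).compr₂ (A x).toLinearMap

theorem secondForm_apply (G : E → E →L[ℝ] E →L[ℝ] ℝ) (Γ' : E' →ₗ[ℝ] E' →ₗ[ℝ] E')
    (A : E → E →L[ℝ] E') (x u v : E) : secondForm G Γ' A x u v =
      fderiv ℝ A x u v + Γ' (A x u) (A x v) -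
        A x (christoffelSymbol (G x) (fderiv ℝ G x) u v) := rfl

theorem fderiv_apply_const {A : E → E →L[ℝ] E'} {x : E} (hA : DifferentiableAt ℝ A x) (u v : E) :
    fderiv ℝ (fun y => A y v) x u = fderiv ℝ A x u v := by
  rw [(hA.hasFDerivAt.clm_apply (hasFDerivAt_const v x)).fderiv]
  simp

namespace IsBiconformalData

variable {G : E → E →L[ℝ] E →L[ℝ] ℝ} {A : E → E →L[ℝ] E'} {s r : E → ℝ} {x : E}
  {G' : E → E →L[ℝ] E →L[ℝ] ℝ} (h : IsBiconformalData G A s r x) (hG' : DifferentiableAt ℝ G' x)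
  (hG'G : ∀ᶠ y in 𝓝 x, G' y = biconformalForm (G y) (A y) (s y) (r y))
  (Γ' : E' →ₗ[ℝ] E' →ₗ[ℝ] E')
include h hG' hG'G

/-- The terms `∂A` and `Γ'(A u, A v)` do not involve the metric of the source, so the change is that
of `-A Γ(u, v)`. -/
theorem secondForm_horizontal (u v : E) :
    secondForm G' Γ' A x (horProj (G x) (A x) u) (horProj (G x) (A x) v) =
      secondForm G Γ' A x (horProj (G x) (A x) u) (horProj (G x) (A x) v) +
      (fderiv ℝ (fun y => Real.log (s y)) x (horProj (G x) (A x) u) • A x v +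
        fderiv ℝ (fun y => Real.log (s y)) x (horProj (G x) (A x) v) • A x u -
        G x (horProj (G x) (A x) u) (horProj (G x) (A x) v) •
          A x ((G x).inverse (fderiv ℝ (fun y => Real.log (s y)) x))) := by
  have hpos := h.pos.self_of_nhds
  have hsurj := h.surj.self_of_nhds
  rw [secondForm_apply, secondForm_apply, h.christoffel_horizontal hG' hG'G
    (horProj_horProj _ hpos _ hsurj u) (horProj_horProj _ hpos _ hsurj v),
    map_horProj _ hpos _ hsurj, map_horProj _ hpos _ hsurj]
  abel

theorem secondForm_vertical (u v : E) :
    r x ^ 2 • secondForm G' Γ' A x (verProj (G x) (A x) u) (verProj (G x) (A x) v) =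
      s x ^ 2 • (secondForm G Γ' A x (verProj (G x) (A x) u) (verProj (G x) (A x) v) -
        G x (verProj (G x) (A x) u) (verProj (G x) (A x) v) •
          A x ((G x).inverse (fderiv ℝ (fun y => Real.log (r y)) x))) := by
  have hpos := h.pos.self_of_nhds
  have hsurj := h.surj.self_of_nhds
  have hA : ∀ u, A x (verProj (G x) (A x) u) = 0 := map_sub_horProj _ hpos _ hsurj
  have := h.christoffel_vertical hG' hG'G (hA u) (hA v)
  rw [secondForm_apply, secondForm_apply, hA, hA, map_zero, add_zero, this]

theorem metricTrace_secondForm :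
    metricTrace (G' x) (fun u v => secondForm G' Γ' A x u v) =
      s x ^ 2 • (metricTrace (G x) (fun u v => secondForm G Γ' A x u v) +
        A x ((G x).inverse ((finrank ℝ E' - finrank ℝ E : ℝ) • fderiv ℝ (fun y => Real.log (r y)) x +
          (2 - finrank ℝ E' : ℝ) • fderiv ℝ (fun y => Real.log (s y)) x))) := by
  rw [hG'G.self_of_nhds]
  exact metricTrace_biconformal_change (G x) h.pos.self_of_nhds h.symm.self_of_nhds (A x)
    h.surj.self_of_nhds _ _ h.s_pos h.r_pos _ _ (h.secondForm_horizontal hG' hG'G Γ')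
    (h.secondForm_vertical hG' hG'G Γ')

/-- The orthogonal projections onto the horizontal space for the two metrics agree. -/
theorem horProj_change : horProj (G' x) (A x) = horProj (G x) (A x) := by
  have hpos := h.pos.self_of_nhds
  have hsurj := h.surj.self_of_nhds
  ext u
  refine (eq_horProj _ (h.pos_change hG' hG'G) _ hsurj _ _ (map_horProj _ hpos _ hsurj u)
    fun w hw => ?_).symm
  have hw0 : horProj (G x) (A x) w = 0 := by simp [horProj, hw]
  rw [hG'G.self_of_nhds, biconformalForm_apply, hw0, horProj_horProj _ hpos _ hsurj]
  simp

theorem verProj_change : verProj (G' x) (A x) = verProj (G x) (A x) := by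
  rw [verProj, verProj, h.horProj_change hG' hG'G]

/-- `Γ'` may be arbitrary here: on vertical vectors it is evaluated at `A u = 0` and contributes
nothing. -/
theorem metricTrace_fibre (S S' : E → E → E)
    (hS : ∀ u v, A x (S u v) =
      -secondForm G Γ' A x (verProj (G x) (A x) u) (verProj (G x) (A x) v))
    (hS' : ∀ u v, A x (S' u v) =
      -secondForm G' Γ' A x (verProj (G' x) (A x) u) (verProj (G' x) (A x) v))
    (hP : ∀ u v, horProj (G x) (A x) (S u v) = S u v)
    (hP' : ∀ u v, horProj (G' x) (A x) (S' u v) = S' u v) :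
    metricTrace (G' x) S' = s x ^ 2 • (metricTrace (G x) S + (finrank ℝ E - finrank ℝ E' : ℝ) •
      horProj (G x) (A x) ((G x).inverse (fderiv ℝ (fun y => Real.log (r y)) x))) := by
  simp only [h.verProj_change hG' hG'G, h.horProj_change hG' hG'G] at hS' hP'
  rw [hG'G.self_of_nhds]
  exact metricTrace_fibre_change (G x) h.pos.self_of_nhds h.symm.self_of_nhds (A x)
    h.surj.self_of_nhds _ _ h.s_pos h.r_pos _
    (h.secondForm_vertical hG' hG'G Γ') S S' hS hS' hP hP'

omit hG' hG'G in
/-- The derivative of a vertical field is determined up to vertical vectors. -/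
theorem map_fderiv_verProj (w v : E) :
    A x (fderiv ℝ (fun y => verProj (G y) (A y) v) x w) =
      -fderiv ℝ A x w (verProj (G x) (A x) v) := by
  have hd : DifferentiableAt ℝ (fun y => verProj (G y) (A y) v) x :=
    ((differentiableAt_const (F := E) v).sub
      (h.differentiableAt_horProj.clm_apply (differentiableAt_const (F := E) v)))
  have h1 : HasFDerivAt (fun y => A y (verProj (G y) (A y) v)) _ x :=
    h.diffA.hasFDerivAt.clm_apply hd.hasFDerivAt
  -- The field is vertical at all nearby points, so the product rule is applied to a function that
  -- is identically zero near `x`.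
  have h2 : HasFDerivAt (fun y => A y (verProj (G y) (A y) v)) (0 : E →L[ℝ] E') x := by
    refine (hasFDerivAt_const (0 : E') x).congr_of_eventuallyEq ?_
    filter_upwards [h.pos, h.surj] with y h1 h2
    exact map_sub_horProj _ h1 _ h2 v
  have h3 := congrArg (fun L : E →L[ℝ] E' => L w) (h1.unique h2)
  simp only [add_apply, ContinuousLinearMap.comp_apply, ContinuousLinearMap.flip_apply,
    zero_apply] at h3
  exact eq_neg_of_add_eq_zero_left h3

end IsBiconformalData

end SecondForm

/-! ### Intrinsic objects on the manifold in terms of their local expressions. -/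

section Global

variable {E : Type*} [NormedAddCommGroup E] [NormedSpace ℝ E] [FiniteDimensional ℝ E]
  {M : Type*} [TopologicalSpace M] [ChartedSpace E M]
  {E' : Type*} [NormedAddCommGroup E'] [NormedSpace ℝ E'] [FiniteDimensional ℝ E']
  {N : Type*} [TopologicalSpace N] [ChartedSpace E' N]
  [IsManifold 𝓘(ℝ, E) ∞ M] [IsManifold 𝓘(ℝ, E') ∞ N]

/-- The Christoffel symbols of `g` at `p` in the chart around `p`, as a bilinear map. -/
def chartChristoffel (g : Metric E M) (p : M) : E →ₗ[ℝ] E →ₗ[ℝ] E :=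
  christoffelSymbol (chartMetric g p (extChartAt 𝓘(ℝ, E) p p))
    (fderiv ℝ (chartMetric g p) (extChartAt 𝓘(ℝ, E) p p))

/-- Equality is stated in `E'`, to which the tangent space at `φ p` unfolds, so that the right side
can use vector space calculus. -/
theorem covDerivAlong_eq (h : Metric E' N) (φ : M → N)
    (S : ∀ q : M, TangentSpace 𝓘(ℝ, E') (φ q)) (p : M) (u : E) (k : E → E')
    (hSk : ∀ᶠ q in 𝓝 p, toChart (φ p) (φ q) (S q) = k (extChartAt 𝓘(ℝ, E) p q))
    (hk : DifferentiableAt ℝ k (extChartAt 𝓘(ℝ, E) p p)) :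
    @Eq E' (covDerivAlong h φ S p u)
      (fderiv ℝ k (extChartAt 𝓘(ℝ, E) p p) u +
        chartChristoffel h (φ p) (mfderiv 𝓘(ℝ, E) 𝓘(ℝ, E') φ p u) (S p)) := by
  unfold covDerivAlong
  rw [ofChart_self (E := E') (φ p), toChart_self (E := E') (φ p), mvfderiv_eq_fderiv hSk hk]
  rfl

theorem leviCivita_eq (g : Metric E M) (Y : ∀ q : M, TangentSpace 𝓘(ℝ, E) q) (p : M) (u : E)
    (k : E → E) (hYk : ∀ᶠ q in 𝓝 p, toChart p q (Y q) = k (extChartAt 𝓘(ℝ, E) p q))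
    (hk : DifferentiableAt ℝ k (extChartAt 𝓘(ℝ, E) p p)) :
    @Eq E (leviCivita g Y p u)
      (fderiv ℝ k (extChartAt 𝓘(ℝ, E) p p) u + chartChristoffel g p u (Y p)) := by
  refine (covDerivAlong_eq g (fun q : M => q) Y p u k hYk hk).trans ?_
  have : mfderiv 𝓘(ℝ, E) 𝓘(ℝ, E) (fun q : M => q) p = ContinuousLinearMap.id ℝ _ := mfderiv_id
  rw [this]
  rfl

variable (g : Metric E M) (h : Metric E' N) (φ : M → N)

theorem hessianMap_eq (hφ : ContMDiff 𝓘(ℝ, E) 𝓘(ℝ, E') ∞ φ) (p : M) (u v : TangentSpace 𝓘(ℝ, E) p) :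
    @Eq E' (hessianMap g h φ p u v)
      (secondForm (chartMetric g p) (chartChristoffel h (φ p)) (chartDeriv φ p)
        (extChartAt 𝓘(ℝ, E) p p) u v) := by
  have h1 := covDerivAlong_eq (E := E) (E' := E') h φ (fun q => mfderiv 𝓘(ℝ, E) 𝓘(ℝ, E') φ q
    (FiberBundle.extend E v q)) p u
    (fun y => chartDeriv (E := E) (E' := E') φ p y v) (by
      filter_upwards [eventually_mem_source (E := E) p] with q ⟨hq, hq'⟩
      rw [extend_eq_ofChart (E := E) p q hq, chartDeriv, hq']
      rfl)
    ((differentiableAt_chartDeriv hφ p).clm_apply (differentiableAt_const (F := E) v))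
  have h2 := leviCivita_eq (E := E) g
    (FiberBundle.extend E v) p u
    (fun _ : E => (v : E)) (by
      filter_upwards [eventually_mem_source (E := E) p] with q ⟨hq, hq'⟩
      rw [extend_eq_ofChart (E := E) p q hq, toChart_ofChart (E := E) p q hq v])
    (differentiableAt_const (F := E) v)
  rw [FiberBundle.extend_apply_self] at h1 h2
  have h3 : fderiv ℝ (fun y => chartDeriv (E := E) (E' := E') φ p y v)
      (extChartAt 𝓘(ℝ, E) p p) u = _ :=
    fderiv_apply_const (E := E) (E' := E') (differentiableAt_chartDeriv hφ p) u v
  replace h1 := h1.trans (congrArg (fun a : E' => a + _) h3)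
  have h4 : ∀ v u : E, fderiv ℝ (fun _ : E => v) (extChartAt 𝓘(ℝ, E) p p) u = 0 := by simp
  replace h2 := h2.trans ((congrArg (fun a : E => a + _) (h4 v u)).trans (zero_add (_ : E)))
  have h5 := secondForm_apply (chartMetric g p) (chartChristoffel h (φ p))
    (chartDeriv (E := E) (E' := E') φ p) (extChartAt 𝓘(ℝ, E) p p) u v
  rw [chartDeriv_self] at h5
  let A : E →L[ℝ] E' := mfderiv 𝓘(ℝ, E) 𝓘(ℝ, E') φ p
  exact (congrArg₂ (fun (a : E') (b : E) => a - A b) h1 h2).trans h5.symm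

/-- The chart isomorphisms carry the metric and `dφ` to their local expressions, hence by naturality
also the orthogonal projections. -/
theorem toChart_vertical_ofChart
    (hsub : ∀ x, Function.Surjective (mfderiv 𝓘(ℝ, E) 𝓘(ℝ, E') φ x)) (p q : M)
    (hq : q ∈ (chartAt E p).source) (hqN : φ q ∈ (chartAt E' (φ p)).source) (v : E) :
    toChart p q (vertical (E' := E') g φ q (ofChart p q v)) =
      verProj (chartMetric g p (extChartAt 𝓘(ℝ, E) p q))
        (chartDeriv (E := E) (E' := E') φ p (extChartAt 𝓘(ℝ, E) p q)) v := by
  have hq' : (extChartAt 𝓘(ℝ, E) p).symm (extChartAt 𝓘(ℝ, E) p q) = q :=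
    (extChartAt 𝓘(ℝ, E) p).left_inv (by simpa using hq)
  have e1 : chartMetric g p (extChartAt 𝓘(ℝ, E) p q) = pullbackForm (g.inner q)
      (chartEquiv p q hq : E →L[ℝ] TangentSpace 𝓘(ℝ, E) q) := by
    rw [coe_chartEquiv, chartMetric, hq']
  have e2 : chartDeriv (E := E) (E' := E') φ p (extChartAt 𝓘(ℝ, E) p q) =
      ((chartEquiv (E := E') (φ p) _ hqN).symm : _ →L[ℝ] E') ∘L
        mfderiv 𝓘(ℝ, E) 𝓘(ℝ, E') φ q ∘L
        (chartEquiv p q hq : E →L[ℝ] TangentSpace 𝓘(ℝ, E) q) := by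
    rw [coe_chartEquiv, coe_chartEquiv_symm, chartDeriv, hq']
  have e3 := horProj_naturality (g.inner q) (g.pos q) _ (hsub q) (chartEquiv p q hq)
    (chartEquiv (E := E') (φ p) _ hqN).symm v
  rw [← e1, ← e2] at e3
  rw [← coe_chartEquiv p q hq, ← coe_chartEquiv_symm p q hq]
  change (chartEquiv p q hq).symm
    (chartEquiv p q hq v - horProj (g.inner q) _ (chartEquiv p q hq v)) = _
  rw [← e3, ← map_sub]
  exact (chartEquiv p q hq).symm_apply_apply _

theorem toChart_vertical (hφ : ContMDiff 𝓘(ℝ, E) 𝓘(ℝ, E') ∞ φ)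
    (hsub : ∀ x, Function.Surjective (mfderiv 𝓘(ℝ, E) 𝓘(ℝ, E') φ x)) (p : M)
    (v : TangentSpace 𝓘(ℝ, E) p) :
    ∀ᶠ q in 𝓝 p, toChart (E := E) p q (vertical (E' := E') g φ q (FiberBundle.extend E v q)) =
      verProj (chartMetric g p (extChartAt 𝓘(ℝ, E) p q))
        (chartDeriv (E := E) (E' := E') φ p (extChartAt 𝓘(ℝ, E) p q)) v := by
  filter_upwards [(chartAt E p).open_source.mem_nhds (mem_chart_source E p),
    (hφ p).continuousAt.eventually
      ((chartAt E' (φ p)).open_source.mem_nhds (mem_chart_source E' (φ p)))] with q hq hqN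
  rw [extend_eq_ofChart (E := E) p q hq]
  exact toChart_vertical_ofChart g φ hsub p q hq hqN v

theorem fibreSecondForm_eq (hφ : ContMDiff 𝓘(ℝ, E) 𝓘(ℝ, E') ∞ φ)
    (hsub : ∀ x, Function.Surjective (mfderiv 𝓘(ℝ, E) 𝓘(ℝ, E') φ x)) (p : M) {s r : E → ℝ}
    (hd : IsBiconformalData (chartMetric g p) (chartDeriv (E := E) (E' := E') φ p) s r
      (extChartAt 𝓘(ℝ, E) p p)) (u v : TangentSpace 𝓘(ℝ, E) p) :
    @Eq E (fibreSecondForm (E' := E') g φ p u v)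
      (horProj (chartMetric g p (extChartAt 𝓘(ℝ, E) p p))
        (chartDeriv (E := E) (E' := E') φ p (extChartAt 𝓘(ℝ, E) p p))
        (fderiv ℝ (fun y => verProj (chartMetric g p y) (chartDeriv (E := E) (E' := E') φ p y) v)
          (extChartAt 𝓘(ℝ, E) p p)
          (verProj (chartMetric g p (extChartAt 𝓘(ℝ, E) p p))
            (chartDeriv (E := E) (E' := E') φ p (extChartAt 𝓘(ℝ, E) p p)) u) +
        chartChristoffel g p
          (verProj (chartMetric g p (extChartAt 𝓘(ℝ, E) p p))
            (chartDeriv (E := E) (E' := E') φ p (extChartAt 𝓘(ℝ, E) p p)) u)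
          (verProj (chartMetric g p (extChartAt 𝓘(ℝ, E) p p))
            (chartDeriv (E := E) (E' := E') φ p (extChartAt 𝓘(ℝ, E) p p)) v))) := by
  have h1 := leviCivita_eq (E := E) g (fun q => vertical (E' := E') g φ q
    (FiberBundle.extend E v q)) p
    (vertical (E' := E') g φ p u) _ (toChart_vertical g φ hφ hsub p v)
    ((differentiableAt_const (F := E) v).sub
      (hd.differentiableAt_horProj.clm_apply (differentiableAt_const (F := E) v)))
  rw [FiberBundle.extend_apply_self] at h1
  rw [chartDeriv_self, chartMetric_self]
  exact congrArg (fun a : E => (horizontal (E' := E') g φ p : E →L[ℝ] E) a) h1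

end Global

/-! ### The tension field and the mean curvature under a biconformal change. -/

section Main

variable {E : Type*} [NormedAddCommGroup E] [NormedSpace ℝ E] [FiniteDimensional ℝ E]
  {M : Type*} [TopologicalSpace M] [ChartedSpace E M]
  {E' : Type*} [NormedAddCommGroup E'] [NormedSpace ℝ E'] [FiniteDimensional ℝ E']
  {N : Type*} [TopologicalSpace N] [ChartedSpace E' N]
  [IsManifold 𝓘(ℝ, E) ∞ M] [IsManifold 𝓘(ℝ, E') ∞ N]

theorem tensionField_eq (g : Metric E M) (h : Metric E' N) {φ : M → N}
    (hφ : ContMDiff 𝓘(ℝ, E) 𝓘(ℝ, E') ∞ φ) (p : M) :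
    @Eq E' (tensionField g h φ p)
      (metricTrace (chartMetric g p (extChartAt 𝓘(ℝ, E) p p)) fun u v =>
        secondForm (chartMetric g p) (chartChristoffel h (φ p)) (chartDeriv φ p)
          (extChartAt 𝓘(ℝ, E) p p) u v) := by
  rw [chartMetric_self]
  exact congrArg (metricTrace (V := E) (W := E') (g.inner p))
    (funext fun u => funext fun v => hessianMap_eq g h φ hφ p u v)

theorem mvfderiv_eq_fderiv_comp_symm {f : M → ℝ} {p : M}
    (hf : ContMDiffAt 𝓘(ℝ, E) 𝓘(ℝ, ℝ) ∞ f p) :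
    @Eq (E →L[ℝ] ℝ) (mvfderiv 𝓘(ℝ, E) f p)
      (fderiv ℝ (fun y => f ((extChartAt 𝓘(ℝ, E) p).symm y)) (extChartAt 𝓘(ℝ, E) p p)) := by
  ext u
  refine mvfderiv_eq_fderiv ?_ ((contDiffAt_comp_extChartAt_symm hf).differentiableAt (by simp)) u
  filter_upwards [eventually_mem_source (E := E) p] with q ⟨_, hq⟩
  rw [hq]

theorem contMDiff_log {f : M → ℝ} (hf : ContMDiff 𝓘(ℝ, E) 𝓘(ℝ, ℝ) ∞ f) (hf0 : ∀ x, 0 < f x) :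
    ContMDiff 𝓘(ℝ, E) 𝓘(ℝ, ℝ) ∞ fun x => Real.log (f x) := fun x =>
  (Real.contDiffAt_log.2 (hf0 x).ne').contMDiffAt.comp x (hf x)

theorem grad_log_eq (g : Metric E M) {f : M → ℝ} (hf : ContMDiff 𝓘(ℝ, E) 𝓘(ℝ, ℝ) ∞ f)
    (hf0 : ∀ x, 0 < f x) (p : M) :
    @Eq E (grad g (fun x => Real.log (f x)) p)
      ((chartMetric g p (extChartAt 𝓘(ℝ, E) p p)).inverse
        (fderiv ℝ (fun y => Real.log (f ((extChartAt 𝓘(ℝ, E) p).symm y)))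
          (extChartAt 𝓘(ℝ, E) p p))) := by
  rw [chartMetric_self]
  let I : (E →L[ℝ] ℝ) →L[ℝ] E := (g.inner p).inverse
  exact congrArg (fun l : E →L[ℝ] ℝ => I l)
    (mvfderiv_eq_fderiv_comp_symm (contMDiff_log hf hf0 p))

theorem grad_log_zpow_mul_zpow (g : Metric E M) {σ ρ : M → ℝ}
    (hσ : ContMDiff 𝓘(ℝ, E) 𝓘(ℝ, ℝ) ∞ σ) (hσ0 : ∀ x, 0 < σ x)
    (hρ : ContMDiff 𝓘(ℝ, E) 𝓘(ℝ, ℝ) ∞ ρ) (hρ0 : ∀ x, 0 < ρ x) (a b : ℤ) (p : M) :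
    grad g (fun x => Real.log (ρ x ^ a * σ x ^ b)) p =
      (a : ℝ) • grad g (fun x => Real.log (ρ x)) p +
        (b : ℝ) • grad g (fun x => Real.log (σ x)) p := by
  have e : (fun x => Real.log (ρ x ^ a * σ x ^ b)) =
      (fun _ : M => (a : ℝ)) • (fun x => Real.log (ρ x)) +
        (fun _ : M => (b : ℝ)) • fun x => Real.log (σ x) := by
    ext x
    rw [Real.log_mul (zpow_pos (hρ0 x) a).ne' (zpow_pos (hσ0 x) b).ne', Real.log_zpow,
      Real.log_zpow]
    rfl
  have d1 := (contMDiff_log hρ hρ0 p).mdifferentiableAt (by simp)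
  have d2 := (contMDiff_log hσ hσ0 p).mdifferentiableAt (by simp)
  have c : ∀ c : ℝ, MDifferentiableAt 𝓘(ℝ, E) 𝓘(ℝ, ℝ) (fun _ : M => c) p := fun c =>
    mdifferentiableAt_const
  unfold grad
  rw [e, mvfderiv_add ((c _).smul d1) ((c _).smul d2), mvfderiv_smul (c _) d1,
    mvfderiv_smul (c _) d2, map_add]
  simp [mvfderiv_const]

variable (g : Metric E M) (h : Metric E' N) (φ : M → N) (σ ρ : M → ℝ)
  (hφ : ContMDiff 𝓘(ℝ, E) 𝓘(ℝ, E') ∞ φ)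
  (hsub : ∀ x, Function.Surjective (mfderiv 𝓘(ℝ, E) 𝓘(ℝ, E') φ x))
  (hσ : ContMDiff 𝓘(ℝ, E) 𝓘(ℝ, ℝ) ∞ σ) (hσ0 : ∀ x, 0 < σ x)
  (hρ : ContMDiff 𝓘(ℝ, E) 𝓘(ℝ, ℝ) ∞ ρ) (hρ0 : ∀ x, 0 < ρ x) (p : M)

/-- The tension field after a biconformal change of metric; neither a Kähler structure nor pseudo
horizontal weak conformality is needed. -/
theorem tensionField_biconformalChange :
    tensionField (biconformalChange g φ σ ρ hφ hsub hσ hσ0 hρ hρ0) h φ p =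
      σ p ^ 2 • (tensionField g h φ p + mfderiv 𝓘(ℝ, E) 𝓘(ℝ, E') φ p
        ((finrank ℝ E' - finrank ℝ E : ℝ) • grad g (fun y => Real.log (ρ y)) p +
          (2 - finrank ℝ E' : ℝ) • grad g (fun y => Real.log (σ y)) p)) := by
  have hd := isBiconformalData_chart g φ σ ρ hφ hsub hσ hσ0 hρ hρ0 p
  have key := hd.metricTrace_secondForm (differentiableAt_chartMetric _ p)
    (chartMetric_biconformalChange g φ σ ρ hφ hsub hσ hσ0 hρ hρ0 p) (chartChristoffel h (φ p))
  rw [map_add, map_smul, map_smul, ← grad_log_eq g hρ hρ0, ← grad_log_eq g hσ hσ0,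
    ← tensionField_eq g h hφ, ← tensionField_eq _ h hφ, chartDeriv_self, extChartAt_to_inv] at key
  exact key

/-- The strict inequality makes the fibre dimension nonzero, so that it cancels against the
coefficient of `grad ln ρ` in the traced identity. -/
theorem meanCurvature_biconformalChange (hdim : finrank ℝ E' < finrank ℝ E) :
    meanCurvature (E' := E') (biconformalChange g φ σ ρ hφ hsub hσ hσ0 hρ hρ0) φ p =
      σ p ^ 2 • (meanCurvature (E' := E') g φ p +
        horizontal (E' := E') g φ p (grad g (fun y => Real.log (ρ y)) p)) := by
  have hd := isBiconformalData_chart g φ σ ρ hφ hsub hσ hσ0 hρ hρ0 p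
  -- For the new metric only positivity, surjectivity and differentiability are used, so the factors
  -- recorded here play no role.
  have hd' := isBiconformalData_chart (biconformalChange g φ σ ρ hφ hsub hσ hσ0 hρ hρ0) φ σ ρ hφ
    hsub hσ hσ0 hρ hρ0 p
  -- The second fundamental form of the fibres is horizontal and projects to that of `φ`.
  have hS : ∀ g : Metric E M, IsBiconformalData (chartMetric g p)
      (chartDeriv (E := E) (E' := E') φ p) (fun y => σ ((extChartAt 𝓘(ℝ, E) p).symm y))
      (fun y => ρ ((extChartAt 𝓘(ℝ, E) p).symm y)) (extChartAt 𝓘(ℝ, E) p p) → ∀ u v : E,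
      chartDeriv (E := E) (E' := E') φ p (extChartAt 𝓘(ℝ, E) p p)
        (fibreSecondForm (E' := E') g φ p u v) =
      -secondForm (chartMetric g p) (0 : E' →ₗ[ℝ] E' →ₗ[ℝ] E')
        (chartDeriv (E := E) (E' := E') φ p)
        (extChartAt 𝓘(ℝ, E) p p)
        (verProj (chartMetric g p (extChartAt 𝓘(ℝ, E) p p))
          (chartDeriv (E := E) (E' := E') φ p (extChartAt 𝓘(ℝ, E) p p)) u)
        (verProj (chartMetric g p (extChartAt 𝓘(ℝ, E) p p))
          (chartDeriv (E := E) (E' := E') φ p (extChartAt 𝓘(ℝ, E) p p)) v) := by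
    intro g hd u v
    refine (congrArg (chartDeriv (E := E) (E' := E') φ p (extChartAt 𝓘(ℝ, E) p p))
      (fibreSecondForm_eq g φ hφ hsub p hd u v)).trans ?_
    rw [map_horProj _ hd.pos.self_of_nhds _ hd.surj.self_of_nhds, map_add, hd.map_fderiv_verProj,
      secondForm_apply, LinearMap.zero_apply, LinearMap.zero_apply, chartChristoffel]
    abel
  have hP : ∀ g : Metric E M, IsBiconformalData (chartMetric g p)
      (chartDeriv (E := E) (E' := E') φ p) (fun y => σ ((extChartAt 𝓘(ℝ, E) p).symm y))
      (fun y => ρ ((extChartAt 𝓘(ℝ, E) p).symm y)) (extChartAt 𝓘(ℝ, E) p p) → ∀ u v : E,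
      @Eq E (horProj (chartMetric g p (extChartAt 𝓘(ℝ, E) p p))
        (chartDeriv (E := E) (E' := E') φ p (extChartAt 𝓘(ℝ, E) p p))
        (fibreSecondForm (E' := E') g φ p u v)) (fibreSecondForm (E' := E') g φ p u v) := by
    intro g hd u v
    have h1 := fibreSecondForm_eq g φ hφ hsub p hd u v
    exact (congrArg _ h1).trans ((horProj_horProj _ hd.pos.self_of_nhds _
      hd.surj.self_of_nhds _).trans h1.symm)
  -- The connection of the target is replaced by `0`, as it does not affect vertical arguments.
  have key := hd.metricTrace_fibre (differentiableAt_chartMetric _ p)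
    (chartMetric_biconformalChange g φ σ ρ hφ hsub hσ hσ0 hρ hρ0 p) 0
    (fibreSecondForm (E' := E') g φ p) (fibreSecondForm (E' := E') _ φ p)
    (hS g hd) (hS _ hd') (hP g hd) (hP _ hd')
  rw [← grad_log_eq g hρ hρ0, chartMetric_self, chartMetric_self, chartDeriv_self,
    extChartAt_to_inv] at key
  have hc : (finrank ℝ (LinearMap.ker (mfderiv 𝓘(ℝ, E) 𝓘(ℝ, E') φ p).toLinearMap) : ℝ) =
      finrank ℝ E - finrank ℝ E' := finrank_ker_eq _ (hsub p)
  have hc0 : (finrank ℝ E - finrank ℝ E' : ℝ) ≠ 0 :=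
    sub_ne_zero.2 (Nat.cast_injective.ne hdim.ne')
  unfold meanCurvature
  rw [hc]
  refine (congrArg (fun w : E => (finrank ℝ E - finrank ℝ E' : ℝ)⁻¹ • w) key).trans ?_
  rw [smul_comm, smul_add, inv_smul_smul₀ hc0]
  rfl

end Main

end Biconformal

end

theorem mainTheorem1 {m n : ℕ}
    {E : Type*} [NormedAddCommGroup E] [NormedSpace ℝ E] [FiniteDimensional ℝ E]
    (hm : finrank ℝ E = m)
    {M : Type*} [TopologicalSpace M] [ChartedSpace E M] [IsManifold 𝓘(ℝ, E) ∞ M]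
    {E' : Type*} [NormedAddCommGroup E'] [NormedSpace ℝ E'] [FiniteDimensional ℝ E']
    (hn : finrank ℝ E' = 2 * n)
    {N : Type*} [TopologicalSpace N] [ChartedSpace E' N] [IsManifold 𝓘(ℝ, E') ∞ N]
    (g : Biconformal.Metric E M) (h : Biconformal.Metric E' N)
    (J : ∀ y : N, TangentSpace 𝓘(ℝ, E') y →L[ℝ] TangentSpace 𝓘(ℝ, E') y)
    (hJ : Biconformal.IsKahler h J)
    (φ : M → N) (hφ : ContMDiff 𝓘(ℝ, E) 𝓘(ℝ, E') ∞ φ)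
    (hsub : ∀ x, Function.Surjective (mfderiv 𝓘(ℝ, E) 𝓘(ℝ, E') φ x))
    (hPHWC : Biconformal.IsPHWC g h J φ)
    (σ ρ : M → ℝ)
    (hσ : ContMDiff 𝓘(ℝ, E) 𝓘(ℝ, ℝ) ∞ σ) (hσ0 : ∀ x, 0 < σ x)
    (hρ : ContMDiff 𝓘(ℝ, E) 𝓘(ℝ, ℝ) ∞ ρ) (hρ0 : ∀ x, 0 < ρ x) :
    (∀ x, Biconformal.tensionField
        (Biconformal.biconformalChange g φ σ ρ hφ hsub hσ hσ0 hρ hρ0) h φ x =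
      σ x ^ 2 • (Biconformal.tensionField g h φ x +
        mfderiv 𝓘(ℝ, E) 𝓘(ℝ, E') φ x
          (Biconformal.grad g
            (fun y => Real.log (ρ y ^ (2 * n - m : ℤ) * σ y ^ (2 - 2 * n : ℤ))) x))) ∧
    (2 * n < m → ∀ x, Biconformal.meanCurvature (E' := E')
        (Biconformal.biconformalChange g φ σ ρ hφ hsub hσ hσ0 hρ hρ0) φ x =
      σ x ^ 2 • (Biconformal.meanCurvature (E' := E') g φ x +
        Biconformal.horizontal (E' := E') g φ x (Biconformal.grad g (fun y => Real.log (ρ y)) x))) := by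
  refine ⟨fun x => ?_, fun hmn x => ?_⟩
  · rw [Biconformal.tensionField_biconformalChange,
      Biconformal.grad_log_zpow_mul_zpow g hσ hσ0 hρ hρ0, hm, hn]
    push_cast
    rfl
  · exact Biconformal.meanCurvature_biconformalChange g φ σ ρ hφ hsub hσ hσ0 hρ hρ0 x
      (by omega)
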